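/- **Theorem (Soundness).** Consider the higher-order logic programming language $\mathcal H$ defined as follows. *Types.* Predicate types are $\pi ::= o \mid (\rho\to\pi)$ and argument types are $\rho ::= \iota\mid\pi$. The alphabet has argument variables of the types $\rho$, predicate constants of the types $\pi$, individual constants of type $\iota$, and function symbols of arity $n\ge 1$. *Expressions.* Positive expressions (identified up to renaming of bound variables) are built from variables, constants, and $\mathsf 0,\mathsf 1:o$ by $(\mathsf f\,\mathsf E_1\cdots\mathsf E_n):\iota$ for $\mathsf E_i:\iota$; application $(\mathsf E_1\mathsf E_2):\pi$ for $\mathsf E_1:\rho\to\pi$, $\mathsf E_2:\rho$; abstraction $(\lambda \mathsf V.\mathsf E):\rho\to\pi$ for $\mathsf V:\rho$, $\mathsf E:\pi$; $(\mathsf E_1\bigvee_\pi\mathsf E_2),(\mathsf E_1\bigwedge_\pi\mathsf E_2):\pi$ for $\mathsf E_1,\mathsf E_2:\pi$; $(\mathsf E_1\approx\mathsf E_2):o$ for $\mathsf E_1,\mathsf E_2:\iota$; and $(\exists\mathsf V\,\mathsf E):o$ for $\mathsf E:o$. A program $\mathsf P$ is a set of clauses $\mathsf p\leftarrow_\pi\mathsf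 E$ with $\mathsf p:\pi$ a predicate constant and $\mathsf E:\pi$ a closed positive expression; a goal is $\mathsf G=\ \leftarrow\mathsf A$ with $\mathsf A:o$ a positive expression. $\Box$ stands for $\mathsf 1$. *Semantics.* For a nonempty set $D$, the complete lattice $[\![\pi]\!]_D$ and the poset $\mathcal F_D(\rho)$ of basic elements are: $[\![o]\!]_D=\{0,1\}$; $[\![\rho\to\pi]\!]_D$ is the set of monotonic maps $\mathcal F_D(\rho)\to[\![\pi]\!]_D$, ordered pointwise; $\mathcal F_D(\iota)=D$ (trivially ordered); $\mathcal F_D(\pi)$ is the set of compact elements of $[\![\pi]\!]_D$. An interpretation $I$ consists of a nonempty domain $D$ and elements of $D$, elements of $[\![\pi]\!]_D$ and maps $D^n\to D$ for the individual constants, predicate constants and function symbols. A state $s$ assigns to each variable $\mathsf V:\rho$ an element of $\mathcal F_D(\rho)$. The value $[\![\mathsf E]\!]_s(I)$ is given by the evident clauses ($\bigvee,\bigwedge$ are binary join and meet, $\approx$ is equality, $\exists\mathsf V$ and $\lambda\mathsf V$ range over $\mathcal F_D(\rho)$), where $[\![(\mathsf E_1\mathsf E_2)]\!]_s(I)=\bigsqcup\{[\![\mathsf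 E_1]\!]_s(I)(b): b\in\mathcal F_D(\rho),\ b\sqsubseteq[\![\mathsf E_2]\!]_s(I)\}$. $I$ is a model of $\mathsf P$ if $[\![\mathsf E]\!]_s(I)\sqsubseteq I(\mathsf p)$ for every clause $\mathsf p\leftarrow_\pi\mathsf E$ of $\mathsf P$ and every state $s$. *Basic expressions.* These are: all expressions of type $\iota$; predicate variables; $\mathsf 0$, $\mathsf 1$; and, at type $\rho_1\to\cdots\to\rho_n\to o$, $n\ge1$, the nonempty finite unions (by $\bigvee$) of expressions $\lambda\mathsf V_1.\cdots\lambda\mathsf V_n.\mathsf 0$ and $\lambda\mathsf V_1.\cdots\lambda\mathsf V_n.(\mathsf A_1\wedge\cdots\wedge\mathsf A_n)$, where $\mathsf A_i$ is $(\mathsf V_i\approx\mathsf B)$ if $\mathsf V_i:\iota$; $\mathsf 1$ or $\mathsf V_i$ if $\mathsf V_i:o$; and otherwise $\mathsf 1$ or a nonempty finite conjunction of formulas $\mathsf V_i(\mathsf B_{1})\cdots(\mathsf B_{r})$; here all the $\mathsf B$'s (the basic subexpressions) are basic expressions in which no $\mathsf V_j$ is free. A basic template is $\mathsf 0$, $\mathsf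 1$, or such a union in which all basic subexpressions are distinct variables. *Substitutions.* A substitution is a finite set of bindings $\mathsf V/\mathsf E$ of equal types; it is basic if all the $\mathsf E$ are basic, and zero-order if all the $\mathsf V$ have type $\iota$. Unifiers and mgu's of two terms are taken among zero-order substitutions. *SLD-resolution.* One-step derivations $\mathsf A\stackrel{\theta}{\to}\mathsf A'$ between formulas ($\epsilon$ the identity substitution) are given by: $\mathsf p\,\mathsf E_1\cdots\mathsf E_n\stackrel{\epsilon}{\to}\mathsf E\,\mathsf E_1\cdots\mathsf E_n$ for $\mathsf p\leftarrow_\pi\mathsf E$ in $\mathsf P$; $\mathsf Q\,\mathsf E_1\cdots\mathsf E_n\stackrel{\theta}{\to}(\mathsf Q\,\mathsf E_1\cdots\mathsf E_n)\theta$ for a predicate variable $\mathsf Q$ and $\theta=\{\mathsf Q/\mathsf B_t\}$ with $\mathsf B_t$ a basic template; $(\lambda\mathsf V.\mathsf E)\,\mathsf E_1\cdots\mathsf E_n\stackrel{\epsilon}{\to}(\mathsf E\{\mathsf V/\mathsf E_1\})\,\mathsf E_2\cdots\mathsf E_n$; $(\mathsf E'\bigvee_\pi\mathsf E'')\,\mathsf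 E_1\cdots\mathsf E_n\stackrel{\epsilon}{\to}\mathsf E'\,\mathsf E_1\cdots\mathsf E_n$ and likewise $\stackrel{\epsilon}{\to}\mathsf E''\,\mathsf E_1\cdots\mathsf E_n$; $(\mathsf E'\bigwedge_\pi\mathsf E'')\,\mathsf E_1\cdots\mathsf E_n\stackrel{\epsilon}{\to}(\mathsf E'\,\mathsf E_1\cdots\mathsf E_n)\wedge(\mathsf E''\,\mathsf E_1\cdots\mathsf E_n)$ for $\pi\ne o$; $\mathsf E_1\wedge\mathsf E_2\stackrel{\theta}{\to}\mathsf E_1'\wedge\mathsf E_2\theta$ if $\mathsf E_1\stackrel{\theta}{\to}\mathsf E_1'$, and symmetrically in the second conjunct; $\Box\wedge\mathsf E\stackrel{\epsilon}{\to}\mathsf E$ and $\mathsf E\wedge\Box\stackrel{\epsilon}{\to}\mathsf E$; $(\mathsf E_1\approx\mathsf E_2)\stackrel{\theta}{\to}\Box$ for $\theta$ an mgu of $\mathsf E_1$ and $\mathsf E_2$; $(\exists\mathsf V\,\mathsf E)\stackrel{\epsilon}{\to}\mathsf E$, where the bound variable $\mathsf V$ is named so that it is not free in the goal. An SLD-refutation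 of $\mathsf P\cup\{\mathsf G\}$ using $\theta=\theta_1\cdots\theta_n$ is a sequence $\mathsf A=\mathsf A_0\stackrel{\theta_1}{\to}\mathsf A_1\stackrel{\theta_2}{\to}\cdots\stackrel{\theta_n}{\to}\mathsf A_n=\Box$ with basic $\theta_i$ such that, whenever $\theta_i=\{\mathsf V/\mathsf B_t\}$ with a basic template $\mathsf B_t$, the free variables of $\mathsf B_t$ have not appeared in the derivation up to $\mathsf A_{i-1}$. A computed answer for $\mathsf P\cup\{\mathsf G\}$ is the restriction of such a $\theta$ to the free variables of $\mathsf G$. A correct answer for $\mathsf P\cup\{\mathsf G\}$ is a basic substitution $\sigma$ for (certain of the) free variables of $\mathsf G$ such that $[\![\mathsf A\sigma]\!]_s(M)=1$ for every model $M$ of $\mathsf P$ and every state $s$ over the domain of $M$. **Claim.** For every program $\mathsf P$ and every goal $\mathsf G=\ \leftarrow\mathsf A$, every computed answer for $\mathsf P\cup\{\mathsf G\}$ is a correct answer for $\mathsf P\cup\{\mathsf G\}$. -/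

import Mathlib

universe u v

namespace HOLP

/-! ### Types -/

mutual
/-- Predicate types `π ::= o | ρ → π`. -/
inductive PredTy : Type
  | o : PredTy
  | arr : ArgTy → PredTy → PredTy
/-- Argument types `ρ ::= ι | π`. -/
inductive ArgTy : Type
  | ind : ArgTy
  | pred : PredTy → ArgTy
end

/-- The alphabet: argument variables of every argument type, predicate constants of every
predicate type, individual constants, and function symbols (`Func n` consists of the function
symbols of arity `n + 1`). -/
structure Signature where
  Var : ArgTy → Type v
  PredConst : PredTy → Type v
  IndConst : Type v
  Func : ℕ → Type v

/-- Contexts of bound variables; the most recently bound variable comes first. -/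
abbrev Ctx := List ArgTy

/-- The bound variables (de Bruijn indices) of type `ρ` in a context. -/
inductive Idx : Ctx → ArgTy → Type
  | here {Γ : Ctx} {ρ : ArgTy} : Idx (ρ :: Γ) ρ
  | there {Γ : Ctx} {ρ ρ' : ArgTy} : Idx Γ ρ → Idx (ρ' :: Γ) ρ

/-- The empty context has no bound variables. -/
def Idx.elim0 {ρ : ArgTy} {α : Sort u} (i : Idx [] ρ) : α := nomatch i

/-- Positive expressions. Expressions are identified up to change of bound variables, so free
variables are named (`fvar`) and bound variables are nameless (`bvar`). The expressions of the
language are those in the empty context; `Γ` lists the variables bound outside of a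
subexpression. -/
inductive Expr (S : Signature.{v}) : Ctx → ArgTy → Type v
  | fvar {Γ : Ctx} {ρ : ArgTy} (V : S.Var ρ) : Expr S Γ ρ
  | bvar {Γ : Ctx} {ρ : ArgTy} (i : Idx Γ ρ) : Expr S Γ ρ
  | pconst {Γ : Ctx} {π : PredTy} (p : S.PredConst π) : Expr S Γ (.pred π)
  | iconst {Γ : Ctx} (c : S.IndConst) : Expr S Γ .ind
  | zero {Γ : Ctx} : Expr S Γ (.pred .o)
  | one {Γ : Ctx} : Expr S Γ (.pred .o)
  | fapp {Γ : Ctx} {n : ℕ} (f : S.Func n) (E : Fin (n + 1) → Expr S Γ .ind) : Expr S Γ .ind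
  | app {Γ : Ctx} {ρ : ArgTy} {π : PredTy}
      (E₁ : Expr S Γ (.pred (.arr ρ π))) (E₂ : Expr S Γ ρ) : Expr S Γ (.pred π)
  | lam {Γ : Ctx} {ρ : ArgTy} {π : PredTy}
      (E : Expr S (ρ :: Γ) (.pred π)) : Expr S Γ (.pred (.arr ρ π))
  | or {Γ : Ctx} {π : PredTy} (E₁ E₂ : Expr S Γ (.pred π)) : Expr S Γ (.pred π)
  | and {Γ : Ctx} {π : PredTy} (E₁ E₂ : Expr S Γ (.pred π)) : Expr S Γ (.pred π)
  | eq {Γ : Ctx} (E₁ E₂ : Expr S Γ .ind) : Expr S Γ (.pred .o)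
  | ex {Γ : Ctx} {ρ : ArgTy} (E : Expr S (ρ :: Γ) (.pred .o)) : Expr S Γ (.pred .o)

/-- Positive formulas; the goal clause `← A` is represented by the formula `A`. -/
abbrev Formula (S : Signature.{v}) := Expr S [] (.pred .o)

/-- Argument variables of any type. -/
abbrev AnyVar (S : Signature.{v}) := Σ ρ : ArgTy, S.Var ρ

namespace Expr

variable {S : Signature.{v}}

/-- The set of free variables. -/
def FV {Γ : Ctx} {ρ : ArgTy} : Expr S Γ ρ → Set (AnyVar S)
  | fvar V => {⟨_, V⟩}
  | bvar _ => ∅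
  | pconst _ => ∅
  | iconst _ => ∅
  | zero => ∅
  | one => ∅
  | fapp _ E => ⋃ i, (E i).FV
  | app E₁ E₂ => E₁.FV ∪ E₂.FV
  | lam E => E.FV
  | or E₁ E₂ => E₁.FV ∪ E₂.FV
  | and E₁ E₂ => E₁.FV ∪ E₂.FV
  | eq E₁ E₂ => E₁.FV ∪ E₂.FV
  | ex E => E.FV

/-- Extend a renaming of bound variables under a binder. -/
def liftRen {Γ Δ : Ctx} {ρ' : ArgTy} (r : ∀ ρ, Idx Γ ρ → Idx Δ ρ) :
    ∀ ρ, Idx (ρ' :: Γ) ρ → Idx (ρ' :: Δ) ρ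
  | _, .here => .here
  | _, .there i => .there (r _ i)

/-- Renaming of bound variables. -/
def rename {Γ Δ : Ctx} {ρ : ArgTy} (r : ∀ ρ, Idx Γ ρ → Idx Δ ρ) : Expr S Γ ρ → Expr S Δ ρ
  | fvar V => fvar V
  | bvar i => bvar (r _ i)
  | pconst p => pconst p
  | iconst c => iconst c
  | zero => zero
  | one => one
  | fapp f E => fapp f fun i => (E i).rename r
  | app E₁ E₂ => app (E₁.rename r) (E₂.rename r)
  | lam E => lam (E.rename (liftRen r))
  | or E₁ E₂ => or (E₁.rename r) (E₂.rename r)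
  | and E₁ E₂ => and (E₁.rename r) (E₂.rename r)
  | eq E₁ E₂ => eq (E₁.rename r) (E₂.rename r)
  | ex E => ex (E.rename (liftRen r))

/-- An expression of the language placed under binders that it does not refer to. -/
def weaken {Γ : Ctx} {ρ : ArgTy} (E : Expr S [] ρ) : Expr S Γ ρ :=
  E.rename fun _ i => i.elim0

/-- Extend an assignment of expressions to bound variables under a binder. -/
def liftSub {Γ Δ : Ctx} {ρ' : ArgTy} (σ : ∀ ρ, Idx Γ ρ → Expr S Δ ρ) :
    ∀ ρ, Idx (ρ' :: Γ) ρ → Expr S (ρ' :: Δ) ρ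
  | _, .here => bvar .here
  | _, .there i => (σ _ i).rename fun _ j => .there j

/-- Replacement of bound variables by expressions. -/
def bsubst {Γ Δ : Ctx} {ρ : ArgTy} (σ : ∀ ρ, Idx Γ ρ → Expr S Δ ρ) : Expr S Γ ρ → Expr S Δ ρ
  | fvar V => fvar V
  | bvar i => σ _ i
  | pconst p => pconst p
  | iconst c => iconst c
  | zero => zero
  | one => one
  | fapp f E => fapp f fun i => (E i).bsubst σ
  | app E₁ E₂ => app (E₁.bsubst σ) (E₂.bsubst σ)
  | lam E => lam (E.bsubst (liftSub σ))
  | or E₁ E₂ => or (E₁.bsubst σ) (E₂.bsubst σ)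
  | and E₁ E₂ => and (E₁.bsubst σ) (E₂.bsubst σ)
  | eq E₁ E₂ => eq (E₁.bsubst σ) (E₂.bsubst σ)
  | ex E => ex (E.bsubst (liftSub σ))

/-- The assignment of the expression `E` to the only bound variable of a context. -/
def instSub {ρ' : ArgTy} (E : Expr S [] ρ') : ∀ ρ, Idx [ρ'] ρ → Expr S [] ρ
  | _, .here => E

/-- `E{V/E'}`, where `V` is the variable bound by the binder whose scope is `E`. -/
def inst {ρ ρ' : ArgTy} (E : Expr S [ρ'] ρ) (E' : Expr S [] ρ') : Expr S [] ρ :=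
  E.bsubst (instSub E')

/-- Application of a map from (free) variables to expressions. -/
def subst {Γ : Ctx} {ρ : ArgTy} (θ : ∀ ρ, S.Var ρ → Expr S [] ρ) : Expr S Γ ρ → Expr S Γ ρ
  | fvar V => (θ _ V).weaken
  | bvar i => bvar i
  | pconst p => pconst p
  | iconst c => iconst c
  | zero => zero
  | one => one
  | fapp f E => fapp f fun i => (E i).subst θ
  | app E₁ E₂ => app (E₁.subst θ) (E₂.subst θ)
  | lam E => lam (E.subst θ)
  | or E₁ E₂ => or (E₁.subst θ) (E₂.subst θ)
  | and E₁ E₂ => and (E₁.subst θ) (E₂.subst θ)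
  | eq E₁ E₂ => eq (E₁.subst θ) (E₂.subst θ)
  | ex E => ex (E.subst θ)

end Expr

/-- Sequences `E₁, …, Eₙ` of arguments to which an expression of type
`π = ρ₁ → ⋯ → ρₙ → o` can be applied, yielding a formula. -/
inductive Args (S : Signature.{v}) (Γ : Ctx) : PredTy → Type v
  | nil : Args S Γ .o
  | cons {ρ : ArgTy} {π : PredTy} (E : Expr S Γ ρ) (as : Args S Γ π) : Args S Γ (.arr ρ π)

namespace Args

variable {S : Signature.{v}}

def toList {Γ : Ctx} {π : PredTy} : Args S Γ π → List (Σ ρ : ArgTy, Expr S Γ ρ)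
  | nil => []
  | cons E as => ⟨_, E⟩ :: as.toList

def weaken {Γ : Ctx} {π : PredTy} : Args S [] π → Args S Γ π
  | nil => nil
  | cons E as => cons E.weaken as.weaken

end Args

/-- `E E₁ ⋯ Eₙ`. -/
def Expr.applyArgs {S : Signature.{v}} {Γ : Ctx} {π : PredTy} (E : Expr S Γ (.pred π)) :
    Args S Γ π → Expr S Γ (.pred .o)
  | .nil => E
  | .cons E' as => (Expr.app E E').applyArgs as

/-! ### Programs -/

/-- A program clause `p ←_π E` with `E` closed. -/
structure Clause (S : Signature.{v}) where
  π : PredTy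
  head : S.PredConst π
  body : Expr S [] (.pred π)
  closed : body.FV = ∅

abbrev Program (S : Signature.{v}) := Set (Clause S)

/-! ### Semantics of types -/

/-- A set with its trivial partial order. -/
@[reducible] def discreteOrder (D : Type u) : PartialOrder D where
  le := Eq
  le_refl _ := rfl
  le_trans _ _ _ := Eq.trans
  le_antisymm _ _ h _ := h

mutual
/-- The complete lattice `⟦π⟧_D`: `⟦o⟧_D = {0, 1}`, and `⟦ρ → π⟧_D` consists of the monotonic
functions from the basic elements of type `ρ` to `⟦π⟧_D`, ordered pointwise (if `ρ = ι`, these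
are all functions from `D` to `⟦π⟧_D`). -/
noncomputable def PredTy.sem (D : Type u) : PredTy → CompleteLat.{u}
  | .o => CompleteLat.of (ULift.{u} Prop)
  | .arr ρ π => CompleteLat.of (ρ.basic D →o π.sem D)
/-- The poset `F_D(ρ)` of basic elements: `D` if `ρ = ι`, and the compact elements of `⟦π⟧_D`
if `ρ = π`. -/
noncomputable def ArgTy.basic (D : Type u) : ArgTy → PartOrd.{u}
  | .ind => @PartOrd.of D (discreteOrder D)
  | .pred π => PartOrd.of {x : π.sem D // IsCompactElement x}
end

/-- The poset `⟦ρ⟧_D`. -/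
noncomputable def ArgTy.sem (D : Type u) : ArgTy → PartOrd.{u}
  | .ind => @PartOrd.of D (discreteOrder D)
  | .pred π => PartOrd.of (π.sem D)

/-- Basic elements of type `ρ` as elements of `⟦ρ⟧_D`. -/
noncomputable def ArgTy.incl (D : Type u) : (ρ : ArgTy) → (ρ.basic D →o ρ.sem D)
  | .ind => ⟨fun d => d, fun _ _ h => h⟩
  | .pred _ => ⟨fun x => x.1, fun _ _ h => h⟩

/-! ### Semantics of expressions -/

/-- Interpretations. -/
structure Interp (S : Signature.{v}) where
  D : Type u
  nonempty : Nonempty D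
  indConst : S.IndConst → D
  predConst : ∀ {π : PredTy}, S.PredConst π → π.sem D
  func : ∀ {n : ℕ}, S.Func n → (Fin (n + 1) → D) → D

/-- States over `D`. -/
abbrev State (S : Signature.{v}) (D : Type u) := ∀ ρ : ArgTy, S.Var ρ → ρ.basic D

/-- Values for the bound variables of a context. -/
abbrev Env (D : Type u) (Γ : Ctx) := ∀ ρ : ArgTy, Idx Γ ρ → ρ.basic D

/-- The environment of the empty context. -/
def Env.nil (D : Type u) : Env D [] := fun _ i => i.elim0

/-- Assign the value `d` to a newly bound variable. -/
def Env.cons {D : Type u} {Γ : Ctx} {ρ : ArgTy} (d : ρ.basic D) (e : Env D Γ) : Env D (ρ :: Γ)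
  | _, .here => d
  | _, .there i => e _ i

theorem Env.cons_le_cons {D : Type u} {Γ : Ctx} {ρ : ArgTy} {d d' : ρ.basic D} {e e' : Env D Γ}
    (hd : d ≤ d') (he : e ≤ e') : Env.cons d e ≤ Env.cons d' e'
  | _, .here => hd
  | _, .there i => he _ i

/-- Semantic application: the supremum of `f b` over the basic elements `b` below `x`. -/
noncomputable def semApp {D : Type u} {ρ : ArgTy} {π : PredTy}
    (f : ρ.basic D →o π.sem D) (x : ρ.sem D) : π.sem D :=
  ⨆ b : {b : ρ.basic D // ρ.incl D b ≤ x}, f b.1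

theorem semApp_le_semApp {D : Type u} {ρ : ArgTy} {π : PredTy}
    {f g : ρ.basic D →o π.sem D} {x y : ρ.sem D} (hf : f ≤ g) (hx : x ≤ y) :
    semApp f x ≤ semApp g y :=
  iSup_le fun b => (hf b.1).trans
    (le_iSup (fun c : {c : ρ.basic D // ρ.incl D c ≤ y} => g c.1) ⟨b.1, b.2.trans hx⟩)

/-- States together with values for the bound variables of a context, ordered pointwise. -/
abbrev Val (S : Signature.{v}) (D : Type u) (Γ : Ctx) := State S D × Env D Γ

section Combinators

variable {S : Signature.{v}} {D : Type u} {Γ : Ctx} {ρ : ArgTy} {π : PredTy}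

noncomputable def Val.fvar (V : S.Var ρ) : Val S D Γ →o ρ.sem D where
  toFun s := ρ.incl D (s.1 ρ V)
  monotone' _ _ h := (ρ.incl D).monotone (h.1 ρ V)

noncomputable def Val.bvar (i : Idx Γ ρ) : Val S D Γ →o ρ.sem D where
  toFun s := ρ.incl D (s.2 ρ i)
  monotone' _ _ h := (ρ.incl D).monotone (h.2 ρ i)

noncomputable def Val.const (x : ρ.sem D) : Val S D Γ →o ρ.sem D where
  toFun _ := x
  monotone' _ _ _ := le_refl x

noncomputable def Val.fapp {n : ℕ} (f : (Fin (n + 1) → D) → D)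
    (x : Fin (n + 1) → (Val S D Γ →o ArgTy.ind.sem D)) : Val S D Γ →o ArgTy.ind.sem D where
  toFun s := f fun i => x i s
  monotone' _ _ h := congrArg f (funext fun i => (x i).monotone h)

noncomputable def Val.app (f : Val S D Γ →o (ArgTy.pred (.arr ρ π)).sem D)
    (x : Val S D Γ →o ρ.sem D) : Val S D Γ →o (ArgTy.pred π).sem D where
  toFun s := semApp (f s) (x s)
  monotone' _ _ h := semApp_le_semApp (f.monotone h) (x.monotone h)

noncomputable def Val.lam (f : Val S D (ρ :: Γ) →o (ArgTy.pred π).sem D) :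
    Val S D Γ →o (ArgTy.pred (.arr ρ π)).sem D where
  toFun s := show ρ.basic D →o π.sem D from
    { toFun := fun d => f (s.1, Env.cons d s.2)
      monotone' := fun _ _ h =>
        f.monotone ⟨le_refl s.1, Env.cons_le_cons h (le_refl s.2)⟩ }
  monotone' _ _ h := fun d => f.monotone ⟨h.1, Env.cons_le_cons (le_refl d) h.2⟩

noncomputable def Val.or (f g : Val S D Γ →o (ArgTy.pred π).sem D) :
    Val S D Γ →o (ArgTy.pred π).sem D where
  toFun s := (max (f s) (g s) : π.sem D)
  monotone' _ _ h := sup_le_sup (α := π.sem D) (f.monotone h) (g.monotone h)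

noncomputable def Val.and (f g : Val S D Γ →o (ArgTy.pred π).sem D) :
    Val S D Γ →o (ArgTy.pred π).sem D where
  toFun s := (min (f s) (g s) : π.sem D)
  monotone' _ _ h := inf_le_inf (α := π.sem D) (f.monotone h) (g.monotone h)

noncomputable def Val.eq (x y : Val S D Γ →o ArgTy.ind.sem D) :
    Val S D Γ →o (ArgTy.pred .o).sem D where
  toFun s := ULift.up.{u} (x s = y s)
  monotone' _ _ h := fun hs : _ = _ => (x.monotone h).symm.trans (hs.trans (y.monotone h))

noncomputable def Val.ex (f : Val S D (ρ :: Γ) →o (ArgTy.pred .o).sem D) :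
    Val S D Γ →o (ArgTy.pred .o).sem D where
  toFun s := ULift.up.{u} (∃ d : ρ.basic D,
    f (s.1, Env.cons d s.2) = (ULift.up True : ULift.{u} Prop))
  monotone' s t h := by
    rintro ⟨d, hd⟩
    have h' : f (s.1, Env.cons d s.2) ≤ f (t.1, Env.cons d t.2) :=
      f.monotone ⟨h.1, Env.cons_le_cons (le_refl d) h.2⟩
    rw [hd] at h'
    exact ⟨d, ULift.ext _ _ (eq_true (h' trivial))⟩

end Combinators

/-- The denotation of an expression, as a function of the state and of the values of the bound
variables. It is a monotonic function, which is what makes the denotation of an abstraction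
an element of the right domain. -/
noncomputable def Expr.denote {S : Signature.{v}} (I : Interp.{u} S) {Γ : Ctx} {ρ : ArgTy} :
    Expr S Γ ρ → (Val S I.D Γ →o ρ.sem I.D)
  | .fvar V => Val.fvar V
  | .bvar i => Val.bvar i
  | .pconst (π := π) p => Val.const (ρ := .pred π) (I.predConst p)
  | .iconst c => Val.const (ρ := .ind) (I.indConst c)
  | .zero => Val.const (ρ := .pred .o) (ULift.up.{u} False)
  | .one => Val.const (ρ := .pred .o) (ULift.up.{u} True)
  | .fapp f E => Val.fapp (I.func f) fun i => (E i).denote I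
  | .app E₁ E₂ => Val.app (E₁.denote I) (E₂.denote I)
  | .lam E => Val.lam (E.denote I)
  | .or E₁ E₂ => Val.or (E₁.denote I) (E₂.denote I)
  | .and E₁ E₂ => Val.and (E₁.denote I) (E₂.denote I)
  | .eq E₁ E₂ => Val.eq (E₁.denote I) (E₂.denote I)
  | .ex E => Val.ex (E.denote I)

/-- `⟦E⟧_s(I)`, for an expression `E` of the language. -/
noncomputable def Expr.val {S : Signature.{v}} {ρ : ArgTy} (E : Expr S [] ρ)
    (I : Interp.{u} S) (s : State S I.D) : ρ.sem I.D :=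
  E.denote I (s, Env.nil I.D)

/-- `⟦A⟧_s(I) = 1`, for a formula `A`. -/
def Formula.IsTrue {S : Signature.{v}} (A : Formula S) (I : Interp.{u} S)
    (s : State S I.D) : Prop :=
  A.val I s = (ULift.up True : ULift.{u} Prop)

/-- `I` is a model of `P`: each clause `p ←_π E` of `P` is true in `I` in every state, that is,
`⟦E⟧_s(I) ⊑ I(p)`. -/
def Interp.IsModel {S : Signature.{v}} (I : Interp.{u} S) (P : Program S) : Prop :=
  ∀ c ∈ P, ∀ s : State S I.D, c.body.val I s ≤ (I.predConst c.head : c.π.sem I.D)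

/-! ### Basic expressions and basic templates -/

/-- The context obtained from `Γ` by binding `V₁ : ρ₁, …, Vₙ : ρₙ`, for
`π = ρ₁ → ⋯ → ρₙ → o`. -/
def PredTy.ctx : PredTy → Ctx → Ctx
  | .o, Γ => Γ
  | .arr ρ π, Γ => π.ctx (ρ :: Γ)

def PredTy.liftIdx {ρ : ArgTy} : (π : PredTy) → {Γ : Ctx} → Idx Γ ρ → Idx (π.ctx Γ) ρ
  | .o, _, i => i
  | .arr _ π, _, i => π.liftIdx (.there i)

/-- The list of bound variables `V₁, …, Vₙ`. -/
def PredTy.vars : (π : PredTy) → (Γ : Ctx) → List (Σ ρ : ArgTy, Idx (π.ctx Γ) ρ)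
  | .o, _ => []
  | .arr ρ π, Γ => ⟨ρ, π.liftIdx .here⟩ :: π.vars (ρ :: Γ)

/-- `λV₁. ⋯ λVₙ. E`. -/
def Expr.lams {S : Signature.{v}} : (π : PredTy) → {Γ : Ctx} →
    Expr S (π.ctx Γ) (.pred .o) → Expr S Γ (.pred π)
  | .o, _, E => E
  | .arr _ π, _, E => .lam (Expr.lams π E)

/-- Lists of (occurrences of) basic subexpressions. -/
abbrev Subs (S : Signature.{v}) := List (Σ ρ : ArgTy, Expr S [] ρ)

/-- `Apps V A l`: `A` is `V(B₁₁)⋯(B₁ᵣ) ∧ ⋯ ∧ V(Bₘ₁)⋯(Bₘᵣ)`, `m > 0`, and `l` is the list of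
the `Bₖₗ`. The bound variables in scope do not occur in the `Bₖₗ`. -/
inductive Apps {S : Signature.{v}} {Γ : Ctx} {π : PredTy} (V : Idx Γ (.pred π)) :
    Expr S Γ (.pred .o) → Subs S → Prop
  | single (as : Args S [] π) : Apps V ((Expr.bvar V).applyArgs as.weaken) as.toList
  | and {A A' : Expr S Γ (.pred .o)} {l l' : Subs S} :
      Apps V A l → Apps V A' l' → Apps V (.and A A') (l ++ l')

/-- `Conjunct V A l`: `A` is an admissible conjunct for the bound variable `V`, and `l` is the
list of its basic subexpressions. -/
inductive Conjunct {S : Signature.{v}} {Γ : Ctx} :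
    {ρ : ArgTy} → Idx Γ ρ → Expr S Γ (.pred .o) → Subs S → Prop
  | eq (V : Idx Γ .ind) (B : Expr S [] .ind) : Conjunct V (.eq (.bvar V) B.weaken) [⟨.ind, B⟩]
  | one {π : PredTy} (V : Idx Γ (.pred π)) : Conjunct V .one []
  | self (V : Idx Γ (.pred .o)) : Conjunct V (.bvar V) []
  | apps {π : PredTy} (V : Idx Γ (.pred π)) {A : Expr S Γ (.pred .o)} {l : Subs S} :
      π ≠ .o → Apps V A l → Conjunct V A l

/-- `Conjunction [V₁, …, Vₙ] A l`: `A` is `A₁ ∧ ⋯ ∧ Aₙ`, `n > 0` (associated in any way), where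
`Aᵢ` is an admissible conjunct for `Vᵢ`, and `l` is the list of the basic subexpressions. -/
inductive Conjunction {S : Signature.{v}} {Γ : Ctx} :
    List (Σ ρ : ArgTy, Idx Γ ρ) → Expr S Γ (.pred .o) → Subs S → Prop
  | single {ρ : ArgTy} {V : Idx Γ ρ} {A : Expr S Γ (.pred .o)} {l : Subs S} :
      Conjunct V A l → Conjunction [⟨ρ, V⟩] A l
  | and {Vs Vs' : List (Σ ρ : ArgTy, Idx Γ ρ)} {A A' : Expr S Γ (.pred .o)} {l l' : Subs S} :
      Conjunction Vs A l → Conjunction Vs' A' l' → Conjunction (Vs ++ Vs') (.and A A') (l ++ l')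

/-- `UnionForm E l`: `E` is a non-empty finite union (associated in any way) of expressions
`λV₁. ⋯ λVₙ. 0` and `λV₁. ⋯ λVₙ. (A₁ ∧ ⋯ ∧ Aₙ)`, where `n ≥ 1` and each `Aᵢ` is an admissible
conjunct for `Vᵢ`, and `l` is the list of the basic subexpressions. -/
inductive UnionForm {S : Signature.{v}} {π : PredTy} : Expr S [] (.pred π) → Subs S → Prop
  | zero : π ≠ .o → UnionForm (Expr.lams π .zero) []
  | conj {A : Expr S (π.ctx []) (.pred .o)} {l : Subs S} :
      π ≠ .o → Conjunction (π.vars []) A l → UnionForm (Expr.lams π A) l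
  | union {E E' : Expr S [] (.pred π)} {l l' : Subs S} :
      UnionForm E l → UnionForm E' l' → UnionForm (.or E E') (l ++ l')

/-- Basic expressions. -/
inductive IsBasic {S : Signature.{v}} : {ρ : ArgTy} → Expr S [] ρ → Prop
  | ind (E : Expr S [] .ind) : IsBasic E
  | pvar {π : PredTy} (V : S.Var (.pred π)) : IsBasic (.fvar V)
  | zero : IsBasic .zero
  | one : IsBasic .one
  | union {π : PredTy} {E : Expr S [] (.pred π)} {l : Subs S} :
      UnionForm E l → (∀ B ∈ l, IsBasic B.2) → IsBasic E

/-- Basic templates: `0`, `1`, and the unions in which all the basic subexpressions are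
distinct variables. -/
inductive IsTemplate {S : Signature.{v}} : {π : PredTy} → Expr S [] (.pred π) → Prop
  | zero : IsTemplate .zero
  | one : IsTemplate .one
  | union {π : PredTy} {E : Expr S [] (.pred π)} {l : Subs S} :
      UnionForm E l → l.Nodup → (∀ B ∈ l, ∃ V : S.Var B.1, B.2 = .fvar V) → IsTemplate E

/-! ### Substitutions -/

/-- Substitutions `{V₁/E₁, …, Vₙ/Eₙ}`, as maps that are the identity outside of a finite set of
variables (trivial bindings `V/V` are disregarded). -/
structure Subst (S : Signature.{v}) where
  toFun : ∀ ρ : ArgTy, S.Var ρ → Expr S [] ρ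
  finite : {V : AnyVar S | toFun V.1 V.2 ≠ .fvar V.2}.Finite

namespace Subst

variable {S : Signature.{v}}

def dom (θ : Subst S) : Set (AnyVar S) := {V | θ.toFun V.1 V.2 ≠ .fvar V.2}

/-- All variables that occur in a substitution. -/
def vars (θ : Subst S) : Set (AnyVar S) := θ.dom ∪ ⋃ V ∈ θ.dom, (θ.toFun V.1 V.2).FV

/-- `Eθ`. -/
def apply (θ : Subst S) {ρ : ArgTy} (E : Expr S [] ρ) : Expr S [] ρ := E.subst θ.toFun

/-- The substitution is basic. -/
def Basic (θ : Subst S) : Prop := ∀ V ∈ θ.dom, IsBasic (θ.toFun V.1 V.2)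

/-- The substitution is zero-order. -/
def ZeroOrder (θ : Subst S) : Prop := ∀ V ∈ θ.dom, V.1 = .ind

/-- The identity substitution `ε`. -/
def id : Subst S where
  toFun _ V := .fvar V
  finite := by simp

/-- The composition `θσ`: first `θ`, then `σ`. -/
def comp (θ σ : Subst S) : Subst S where
  toFun ρ V := σ.apply (θ.toFun ρ V)
  finite := by
    refine (θ.finite.union σ.finite).subset fun V hV => ?_
    by_contra h
    simp only [Set.mem_union, Set.mem_ofPred_eq, not_or, not_not] at h
    refine hV ?_
    simp only [apply, h.1, Expr.subst, h.2, Expr.weaken, Expr.rename]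

open Classical in
/-- The substitution `{V/E}`. -/
noncomputable def single {ρ : ArgTy} (V : S.Var ρ) (E : Expr S [] ρ) : Subst S where
  toFun ρ' W := if h : ∃ e : ρ = ρ', e ▸ V = W then h.1 ▸ E else .fvar W
  finite := by
    refine (Set.finite_singleton (⟨ρ, V⟩ : AnyVar S)).subset fun W hW => ?_
    by_contra h
    obtain ⟨ρ', W⟩ := W
    have h' : ¬ ∃ e : ρ = ρ', e ▸ V = W := by
      rintro ⟨rfl, rfl⟩
      exact h rfl
    exact hW (dif_neg h')

open Classical in
/-- The restriction of a substitution to a set of variables. -/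
noncomputable def restrict (θ : Subst S) (X : Set (AnyVar S)) : Subst S where
  toFun ρ V := if (⟨ρ, V⟩ : AnyVar S) ∈ X then θ.toFun ρ V else .fvar V
  finite := by
    refine θ.finite.subset fun V hV h => hV ?_
    split
    · exact h
    · rfl

/-- `θ` is a unifier of two terms. -/
def IsUnifier (θ : Subst S) (E₁ E₂ : Expr S [] .ind) : Prop :=
  θ.ZeroOrder ∧ θ.apply E₁ = θ.apply E₂

/-- `θ` is a most general unifier of two terms. -/
def IsMGU (θ : Subst S) (E₁ E₂ : Expr S [] .ind) : Prop :=
  θ.IsUnifier E₁ E₂ ∧ ∀ σ : Subst S, σ.IsUnifier E₁ E₂ → ∃ γ : Subst S, γ.ZeroOrder ∧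
    σ = θ.comp γ

end Subst

/-! ### SLD-resolution -/

/-- The rules for deriving a formula in one step, where `X` is a set of variables that are not
to be used as names for bound variables. The empty clause `□` is the constant `1`. -/
inductive StepAvoiding {S : Signature.{v}} (P : Program S) (X : Set (AnyVar S)) :
    Formula S → Subst S → Formula S → Prop
  | clause (c : Clause S) (hc : c ∈ P) (as : Args S [] c.π) :
      StepAvoiding P X ((Expr.pconst c.head).applyArgs as) .id (c.body.applyArgs as)
  | template {π : PredTy} (Q : S.Var (.pred π)) (B : Expr S [] (.pred π)) (as : Args S [] π) :
      IsTemplate B →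
      StepAvoiding P X ((Expr.fvar Q).applyArgs as) (.single Q B)
        ((Subst.single Q B).apply ((Expr.fvar Q).applyArgs as))
  | beta {ρ : ArgTy} {π : PredTy} (E : Expr S [ρ] (.pred π)) (E₁ : Expr S [] ρ)
      (as : Args S [] π) :
      StepAvoiding P X ((Expr.lam E).applyArgs (.cons E₁ as)) .id ((E.inst E₁).applyArgs as)
  | orLeft {π : PredTy} (E E' : Expr S [] (.pred π)) (as : Args S [] π) :
      StepAvoiding P X ((Expr.or E E').applyArgs as) .id (E.applyArgs as)
  | orRight {π : PredTy} (E E' : Expr S [] (.pred π)) (as : Args S [] π) :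
      StepAvoiding P X ((Expr.or E E').applyArgs as) .id (E'.applyArgs as)
  | andApp {π : PredTy} (E E' : Expr S [] (.pred π)) (as : Args S [] π) : π ≠ .o →
      StepAvoiding P X ((Expr.and E E').applyArgs as) .id
        (.and (E.applyArgs as) (E'.applyArgs as))
  | andLeft {E₁ E₁' : Formula S} (E₂ : Formula S) {θ : Subst S} : StepAvoiding P X E₁ θ E₁' →
      StepAvoiding P X (.and E₁ E₂) θ (.and E₁' (θ.apply E₂))
  | andRight (E₁ : Formula S) {E₂ E₂' : Formula S} {θ : Subst S} : StepAvoiding P X E₂ θ E₂' →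
      StepAvoiding P X (.and E₁ E₂) θ (.and (θ.apply E₁) E₂')
  | oneAnd (E : Formula S) : StepAvoiding P X (.and .one E) .id E
  | andOne (E : Formula S) : StepAvoiding P X (.and E .one) .id E
  | eq (E₁ E₂ : Expr S [] .ind) (θ : Subst S) : θ.IsMGU E₁ E₂ →
      StepAvoiding P X (.eq E₁ E₂) θ .one
  | ex {ρ : ArgTy} (E : Expr S [ρ] (.pred .o)) (V : S.Var ρ) : (⟨ρ, V⟩ : AnyVar S) ∉ X →
      StepAvoiding P X (.ex E) .id (E.inst (.fvar V))

/-- `A'` is derived in one step from `A` using `θ`. By the variable convention, the bound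
variables of `A` are named differently from its free variables. -/
def Step {S : Signature.{v}} (P : Program S) (A : Formula S) (θ : Subst S)
    (A' : Formula S) : Prop :=
  StepAvoiding P A.FV A θ A'

/-- A finite SLD-derivation `G 0, …, G n` with substitutions `θ 0, …, θ (n - 1)`, where `θ i`
leads from `G i` to `G (i + 1)` (the values of `G` and `θ` at larger indices are irrelevant).
Whenever `θ i = {V/B}` with a basic template `B`, the free variables of `B` have not appeared
in the derivation up to `G i`. -/
structure IsDerivation {S : Signature.{v}} (P : Program S) (n : ℕ) (G : ℕ → Formula S)
    (θ : ℕ → Subst S) : Prop where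
  basic : ∀ i < n, (θ i).Basic
  step : ∀ i < n, Step P (G i) (θ i) (G (i + 1))
  fresh : ∀ i < n, ∀ (π : PredTy) (V : S.Var (.pred π)) (B : Expr S [] (.pred π)),
    IsTemplate B → θ i = .single V B →
      Disjoint B.FV ((⋃ j ≤ i, (G j).FV) ∪ ⋃ j < i, (θ j).vars)

/-- The composition `θ 0 ⋯ θ (n - 1)`. -/
def composite {S : Signature.{v}} (θ : ℕ → Subst S) : ℕ → Subst S
  | 0 => .id
  | n + 1 => (composite θ n).comp (θ n)

/-- `P ∪ {← A}` has an SLD-refutation of length `n` using `θ`. -/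
def HasRefutation {S : Signature.{v}} (P : Program S) (A : Formula S) (n : ℕ)
    (θ : Subst S) : Prop :=
  ∃ (G : ℕ → Formula S) (θs : ℕ → Subst S),
    IsDerivation P n G θs ∧ G 0 = A ∧ G n = .one ∧ θ = composite θs n

/-- `σ` is a computed answer for `P ∪ {← A}`. -/
def IsComputedAnswer {S : Signature.{v}} (P : Program S) (A : Formula S) (σ : Subst S) : Prop :=
  ∃ (n : ℕ) (θ : Subst S), HasRefutation P A n θ ∧ σ = θ.restrict A.FV

/-- `θ` is an answer for `P ∪ {← A}`: a basic substitution for free variables of `A`. -/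
def IsAnswer {S : Signature.{v}} (A : Formula S) (θ : Subst S) : Prop :=
  θ.Basic ∧ θ.dom ⊆ A.FV

/-- `θ` is a correct answer for `P ∪ {← A}`: an answer such that `Aθ` is true in every model of
`P` in every state. -/
def IsCorrectAnswer {S : Signature.{v}} (P : Program S) (A : Formula S) (θ : Subst S) : Prop :=
  IsAnswer A θ ∧
    ∀ M : Interp.{u} S, M.IsModel P → ∀ s : State S M.D, Formula.IsTrue (θ.apply A) M s

end HOLP

-- Soundness is proved backwards along the refutation: if `A` yields `A'` in one step using `θ`,
-- then in every model and every state the truth of `A'` implies the truth of `Aθ`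
-- (`StepAvoiding.isTrue`). Starting from `□`, which is true, this gives the truth of the initial
-- goal under the composite substitution (`IsDerivation.isTrue`). Two semantic facts carry the
-- argument.
--
-- First, a basic expression denotes a basic element (`IsBasic.denotesBasic`). An element of `⟦π⟧_D`
-- is determined by the tuples of basic elements at which it is true (`le_iff_eval`), and for each
-- tuple `c` there is a least element `step c` true at `c`, which is compact because truth at `c`
-- commutes with suprema. Each conjunct in a basic expression says that its variable lies above some
-- fixed basic element, so an abstracted conjunction denotes a `step c`, and a finite union denotes
-- a finite join of compact elements. Hence applying a basic substitution only changes the state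
-- (`Subst.Basic.exists_state`), and a statement about all states is stable under it.
--
-- Second, beta reduction and the removal of `∃` substitute expressions whose values need not be
-- basic, while abstraction and quantification range over basic elements only. What is needed is
-- that the value of `E{V/E₁}` is below every upper bound of the values of `E` at basic elements
-- below `E₁` (`denote_bsubst_le`), which is continuity: the basic elements below a value are
-- directed, and a compact element below a directed supremum is below a member.
--
-- That answers are themselves basic is syntactic: basic expressions are closed under basic
-- substitutions (`IsBasic.subst`).

namespace HOLP

/-! ### Evaluation of predicates at tuples of basic elements -/

/-- Tuples of basic elements to which an element of `⟦π⟧_D` can be applied. -/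
inductive Tuple (D : Type u) : PredTy → Type u
  | nil : Tuple D .o
  | cons {ρ : ArgTy} {π : PredTy} (d : ρ.basic D) (t : Tuple D π) : Tuple D (.arr ρ π)

/-- The pointwise order on tuples. -/
def Tuple.Le {D : Type u} : {π : PredTy} → Tuple D π → Tuple D π → Prop
  | _, .nil, .nil => True
  | _, .cons d t, .cons d' t' => d ≤ d' ∧ t.Le t'

/-- `eval f (d₁, …, dₙ)` says that `f d₁ ⋯ dₙ = 1`. -/
def eval {D : Type u} : {π : PredTy} → π.sem D → Tuple D π → Prop
  | _, f, .nil => ULift.down.{u} (α := Prop) f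
  | .arr ρ π, f, .cons d t => eval (π := π) ((show ρ.basic D →o π.sem D from f) d) t

section Eval

variable {D : Type u}

/-- The order at arrow types is pointwise, so unfolding the type down to `o` leaves implications
between truth values. This turns lattice inequalities into statements about tuples. -/
theorem le_iff_eval : {π : PredTy} → {f g : π.sem D} →
    (f ≤ g ↔ ∀ t, eval f t → eval g t)
  | .o, _, _ => ⟨fun h t => by cases t; exact h, fun h => h .nil⟩
  | .arr _ _, _, _ =>
    ⟨fun h t => by cases t with | cons d t => exact le_iff_eval.1 (h d) t,
      fun h d => le_iff_eval.2 fun t => h (.cons d t)⟩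

theorem eval_mono_tuple : {π : PredTy} → {f : π.sem D} → {t t' : Tuple D π} →
    t.Le t' → eval f t → eval f t'
  | _, _, .nil, .nil, _, h => h
  | .arr ρ π, f, .cons _ t, .cons d' t', hle, h =>
    eval_mono_tuple (f := (show ρ.basic D →o π.sem D from f) d') (t := t) (t' := t') hle.2
      (le_iff_eval.1 ((show ρ.basic D →o π.sem D from f).monotone hle.1) t h)

/-- Suprema of monotone maps are computed pointwise, and a supremum of propositions is an
existential. -/
theorem eval_iSup {ι : Sort*} : {π : PredTy} → {f : ι → π.sem D} → {t : Tuple D π} →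
    (eval (⨆ i, f i) t ↔ ∃ i, eval (f i) t)
  | _, f, .nil => by
    change (⨆ i, (show ULift.{u} Prop from f i)).down ↔ _
    rw [ULift.down_iSup, iSup_Prop_eq]
    rfl
  | .arr ρ π, f, .cons d t => by
    change eval ((⨆ i, (show ρ.basic D →o π.sem D from f i)) d) t ↔ _
    rw [OrderHom.iSup_apply, eval_iSup]
    rfl

theorem eval_inf : {π : PredTy} → {f g : π.sem D} → {t : Tuple D π} →
    (eval (f ⊓ g) t ↔ eval f t ∧ eval g t)
  | _, _, _, .nil => Iff.rfl
  | .arr _ _, _, _, .cons _ t => eval_inf (t := t)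

theorem eval_sSup {π : PredTy} {s : Set (π.sem D)} {t : Tuple D π} :
    eval (sSup s) t ↔ ∃ f ∈ s, eval f t := by
  rw [sSup_eq_iSup', eval_iSup, Subtype.exists]
  simp only [exists_prop]

-- Step functions, compactness and algebraicity

/-- The least element of `⟦π⟧_D` that is true at the tuple `c`. -/
noncomputable def step : {π : PredTy} → Tuple D π → π.sem D
  | _, .nil => (ULift.up True : ULift.{u} Prop)
  | .arr ρ π, .cons c t => show ρ.basic D →o π.sem D from
    { toFun := fun d => ⨆ _ : c ≤ d, step t
      monotone' := fun _ _ h => iSup_mono' fun hc => ⟨hc.trans h, le_rfl⟩ }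

theorem eval_step : {π : PredTy} → {c t : Tuple D π} → (eval (step c) t ↔ c.Le t)
  | _, .nil, .nil => Iff.rfl
  | .arr ρ π, .cons c t, .cons d t' => by
    change eval (⨆ _ : c ≤ d, step t) t' ↔ c ≤ d ∧ t.Le t'
    rw [eval_iSup, eval_step, exists_prop]

theorem Tuple.Le.refl : {π : PredTy} → (t : Tuple D π) → t.Le t
  | _, .nil => trivial
  | _, .cons d t => ⟨le_refl d, Tuple.Le.refl t⟩

theorem step_le_iff {π : PredTy} {c : Tuple D π} {f : π.sem D} : step c ≤ f ↔ eval f c := by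
  rw [le_iff_eval]
  exact ⟨fun h => h c (eval_step.2 (.refl c)), fun h t ht => eval_mono_tuple (eval_step.1 ht) h⟩

/-- Lying above `step c` means being true at `c`, and a supremum is true at `c` only if some member
is: `step c` is completely join-prime. -/
theorem isCompactElement_step {π : PredTy} (c : Tuple D π) : IsCompactElement (step c) := by
  rw [CompleteLattice.isCompactElement_iff_le_of_directed_sSup_le]
  intro s _ _ h
  rw [step_le_iff, eval_sSup] at h
  exact h.imp fun f hf => ⟨hf.1, step_le_iff.2 hf.2⟩

theorem isCompactElement_bot {π : PredTy} : IsCompactElement (⊥ : π.sem D) :=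
  fun _ _ hs _ _ _ => hs.imp fun _ hx => ⟨hx, bot_le⟩

theorem isCompactElement_sup {π : PredTy} {x y : π.sem D} (hx : IsCompactElement x)
    (hy : IsCompactElement y) : IsCompactElement (x ⊔ y) := by
  intro s u hs hd hu h
  obtain ⟨a, ha, hxa⟩ := hx s u hs hd hu (le_sup_left.trans h)
  obtain ⟨b, hb, hyb⟩ := hy s u hs hd hu (le_sup_right.trans h)
  obtain ⟨c, hc, hac, hbc⟩ := hd a ha b hb
  exact ⟨c, hc, sup_le (hxa.trans hac) (hyb.trans hbc)⟩

/-- The lattice `⟦π⟧_D` is algebraic. -/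
theorem le_of_forall_compact_le {π : PredTy} {x y : π.sem D}
    (h : ∀ c : π.sem D, IsCompactElement c → c ≤ x → c ≤ y) : x ≤ y :=
  le_iff_eval.2 fun t ht =>
    step_le_iff.1 (h (step t) (isCompactElement_step t) (step_le_iff.2 ht))

/-! ### Basic elements below a given element -/

theorem le_of_forall_basic_le : {ρ : ArgTy} → {x y : ρ.sem D} →
    (∀ b : ρ.basic D, ρ.incl D b ≤ x → ρ.incl D b ≤ y) → x ≤ y
  | .ind, x, _, h => h x (le_refl x)
  | .pred _, _, _, h => le_of_forall_compact_le fun c hc => h ⟨c, hc⟩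

theorem exists_basic_le : {ρ : ArgTy} → (x : ρ.sem D) → ∃ b : ρ.basic D, ρ.incl D b ≤ x
  | .ind, x => ⟨x, le_refl x⟩
  | .pred π, _ => ⟨⟨(⊥ : π.sem D), isCompactElement_bot⟩, bot_le (α := π.sem D)⟩

/-- Directedness of the basic elements below `x`: compact elements are closed under binary joins,
and at type `ι` both elements equal `x`. -/
theorem exists_basic_ge_ge : {ρ : ArgTy} → {x : ρ.sem D} → (b b' : ρ.basic D) →
    ρ.incl D b ≤ x → ρ.incl D b' ≤ x → ∃ c : ρ.basic D, b ≤ c ∧ b' ≤ c ∧ ρ.incl D c ≤ x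
  | .ind, _, b, _, h, h' => ⟨b, le_refl b, h'.trans h.symm, h⟩
  | .pred π, _, b, b', h, h' =>
    ⟨⟨(b.1 ⊔ b'.1 : π.sem D), isCompactElement_sup b.2 b'.2⟩, le_sup_left (α := π.sem D),
      le_sup_right (α := π.sem D), sup_le (α := π.sem D) h h'⟩

theorem incl_le_incl : {ρ : ArgTy} → {b b' : ρ.basic D} →
    (ρ.incl D b ≤ ρ.incl D b' ↔ b ≤ b')
  | .ind, _, _ => Iff.rfl
  | .pred _, _, _ => Iff.rfl

/-- A basic element below the supremum of a directed family is below one of its members. -/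
theorem exists_le_of_directed {ι : Type*} [Nonempty ι] : {ρ : ArgTy} → {x : ρ.sem D} →
    {f : ι → ρ.sem D} → Directed (· ≤ ·) f → (∀ u, (∀ i, f i ≤ u) → x ≤ u) →
    (b : ρ.basic D) → ρ.incl D b ≤ x → ∃ i, ρ.incl D b ≤ f i
  -- The order on `D` is equality, so a directed family is constant and any index serves.
  | .ind, x, f, hd, hx, b, hb => by
    obtain ⟨i⟩ := ‹Nonempty ι›
    refine ⟨i, hb.trans (hx (f i) fun j => ?_)⟩
    obtain ⟨k, hik, hjk⟩ := hd i j
    exact hjk.trans hik.symm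
  | .pred π, x, f, hd, hx, b, hb => by
    obtain ⟨_, ⟨i, rfl⟩, hi⟩ := b.2 (Set.range f) (sSup (α := π.sem D) (Set.range f))
      (Set.range_nonempty f) hd.directedOn_range (isLUB_sSup (α := π.sem D) _)
      (hb.trans (hx _ fun i => le_sSup (α := π.sem D) ⟨i, rfl⟩))
    exact ⟨i, hi⟩

theorem eval_semApp {ρ : ArgTy} {π : PredTy} {f : ρ.basic D →o π.sem D} {x : ρ.sem D}
    {t : Tuple D π} :
    eval (semApp f x) t ↔ ∃ b : ρ.basic D, ρ.incl D b ≤ x ∧ eval (f b) t := by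
  unfold semApp
  rw [eval_iSup, Subtype.exists]
  simp only [exists_prop]

end Eval

/-! ### Syntactic properties of substitution -/

section Substitution

variable {S : Signature.{v}}

theorem Expr.liftRen_id {Γ : Ctx} {ρ' : ArgTy} :
    liftRen (fun ρ (i : Idx Γ ρ) => i) (ρ' := ρ') = fun _ i => i := by
  funext ρ i
  cases i <;> rfl

theorem Expr.liftRen_comp {Γ Δ Θ : Ctx} {ρ' : ArgTy} (r : ∀ ρ, Idx Γ ρ → Idx Δ ρ)
    (r' : ∀ ρ, Idx Δ ρ → Idx Θ ρ) :
    (fun ρ i => liftRen r' ρ (liftRen r (ρ' := ρ') ρ i)) = liftRen fun ρ i => r' ρ (r ρ i) := by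
  funext ρ i
  cases i <;> rfl

theorem Expr.rename_id {Γ : Ctx} {ρ : ArgTy} (E : Expr S Γ ρ) : E.rename (fun _ i => i) = E := by
  induction E <;> simp_all [Expr.rename, Expr.liftRen_id]

theorem Expr.rename_rename {Γ : Ctx} {ρ : ArgTy} (E : Expr S Γ ρ) {Δ Θ : Ctx}
    (r : ∀ ρ, Idx Γ ρ → Idx Δ ρ) (r' : ∀ ρ, Idx Δ ρ → Idx Θ ρ) :
    (E.rename r).rename r' = E.rename fun ρ i => r' ρ (r ρ i) := by
  induction E generalizing Δ Θ <;> simp_all [Expr.rename, Expr.liftRen_comp]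

theorem Expr.weaken_nil {ρ : ArgTy} (E : Expr S [] ρ) : (E.weaken : Expr S [] ρ) = E := by
  have : (fun ρ (i : Idx [] ρ) => (i.elim0 : Idx [] ρ)) = fun _ i => i := by
    funext ρ i
    cases i
  rw [Expr.weaken, this, Expr.rename_id]

theorem Expr.rename_weaken {Γ Δ : Ctx} {ρ : ArgTy} (E : Expr S [] ρ)
    (r : ∀ ρ, Idx Γ ρ → Idx Δ ρ) : E.weaken.rename r = E.weaken := by
  rw [Expr.weaken, Expr.rename_rename]
  congr 1
  funext ρ i
  cases i

theorem Expr.subst_rename {Γ : Ctx} {ρ : ArgTy} (E : Expr S Γ ρ) {Δ : Ctx}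
    (r : ∀ ρ, Idx Γ ρ → Idx Δ ρ) (θ : ∀ ρ, S.Var ρ → Expr S [] ρ) :
    (E.rename r).subst θ = (E.subst θ).rename r := by
  induction E generalizing Δ <;> simp_all [Expr.rename, Expr.subst, Expr.rename_weaken]

theorem Expr.subst_weaken {Γ : Ctx} {ρ : ArgTy} (E : Expr S [] ρ)
    (θ : ∀ ρ, S.Var ρ → Expr S [] ρ) :
    (E.weaken : Expr S Γ ρ).subst θ = (E.subst θ).weaken :=
  E.subst_rename _ θ

theorem Expr.subst_subst {Γ : Ctx} {ρ : ArgTy} (E : Expr S Γ ρ)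
    (θ σ : ∀ ρ, S.Var ρ → Expr S [] ρ) :
    (E.subst θ).subst σ = E.subst fun ρ V => (θ ρ V).subst σ := by
  induction E <;> simp_all [Expr.subst, Expr.subst_weaken]

theorem Expr.subst_fvar {Γ : Ctx} {ρ : ArgTy} (E : Expr S Γ ρ) :
    E.subst (fun _ V => .fvar V) = E := by
  induction E <;> simp_all [Expr.subst, Expr.weaken, Expr.rename]

theorem Expr.subst_congr {Γ : Ctx} {ρ : ArgTy} (E : Expr S Γ ρ)
    {θ σ : ∀ ρ, S.Var ρ → Expr S [] ρ} (h : ∀ V ∈ E.FV, θ V.1 V.2 = σ V.1 V.2) :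
    E.subst θ = E.subst σ := by
  induction E with
  | fvar V => exact congrArg Expr.weaken (h ⟨_, V⟩ rfl)
  | fapp f E ih =>
    simp only [Expr.subst]
    congr 1
    funext i
    exact ih i fun V hV => h V (Set.mem_iUnion.2 ⟨i, hV⟩)
  | app E₁ E₂ ih₁ ih₂ | or E₁ E₂ ih₁ ih₂ | and E₁ E₂ ih₁ ih₂ | eq E₁ E₂ ih₁ ih₂ =>
    simp only [Expr.subst]
    rw [ih₁ fun V hV => h V (.inl hV), ih₂ fun V hV => h V (.inr hV)]
  | lam E ih | ex E ih =>
    simp only [Expr.subst]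
    rw [ih h]
  | _ => rfl

/-- Application of a substitution to each argument. -/
def Args.subst {Γ : Ctx} (θ : ∀ ρ, S.Var ρ → Expr S [] ρ) :
    {π : PredTy} → Args S Γ π → Args S Γ π
  | _, .nil => .nil
  | _, .cons E as => .cons (E.subst θ) (as.subst θ)

theorem Args.subst_weaken {Γ : Ctx} (θ : ∀ ρ, S.Var ρ → Expr S [] ρ) {π : PredTy}
    (as : Args S [] π) : (as.weaken : Args S Γ π).subst θ = (as.subst θ).weaken := by
  induction as with
  | nil => rfl
  | cons E as ih => simp only [Args.weaken, Args.subst, ih, Expr.subst_weaken]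

/-- Application of a substitution to each member of a list of basic subexpressions. -/
def Subs.subst (θ : ∀ ρ, S.Var ρ → Expr S [] ρ) (l : Subs S) : Subs S :=
  l.map fun B => ⟨B.1, B.2.subst θ⟩

theorem Args.toList_subst (θ : ∀ ρ, S.Var ρ → Expr S [] ρ) {π : PredTy}
    (as : Args S [] π) : (as.subst θ).toList = Subs.subst θ as.toList := by
  induction as with
  | nil => rfl
  | cons E as ih => simp only [Args.toList, Args.subst, ih, Subs.subst, List.map_cons]

theorem Expr.subst_applyArgs {Γ : Ctx} (θ : ∀ ρ, S.Var ρ → Expr S [] ρ) {π : PredTy}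
    (E : Expr S Γ (.pred π)) (as : Args S Γ π) :
    (E.applyArgs as).subst θ = (E.subst θ).applyArgs (as.subst θ) := by
  induction as with
  | nil => rfl
  | cons E' as ih => exact ih _

theorem Expr.subst_lams (θ : ∀ ρ, S.Var ρ → Expr S [] ρ) : (π : PredTy) → {Γ : Ctx} →
    (E : Expr S (π.ctx Γ) (.pred .o)) → (Expr.lams π E).subst θ = Expr.lams π (E.subst θ)
  | .o, _, _ => rfl
  | .arr _ π, _, E => congrArg Expr.lam (Expr.subst_lams θ π E)

/-! ### Substitution preserves basic expressions -/

variable {θ : ∀ ρ, S.Var ρ → Expr S [] ρ}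

/-- The head is a bound variable, which `θ` leaves alone, and the arguments are weakened from the
empty context, so `θ` acts on them without capture. -/
theorem Apps.subst {Γ : Ctx} {π : PredTy} {V : Idx Γ (.pred π)} {A : Expr S Γ (.pred .o)}
    {l : Subs S} (h : Apps V A l) : Apps V (A.subst θ) (Subs.subst θ l) := by
  induction h with
  | single as =>
    rw [Expr.subst_applyArgs, Args.subst_weaken, ← Args.toList_subst]
    exact .single _
  | and _ _ ih ih' =>
    rw [Subs.subst, List.map_append]
    exact .and ih ih'

theorem Conjunct.subst {Γ : Ctx} {ρ : ArgTy} {V : Idx Γ ρ} {A : Expr S Γ (.pred .o)}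
    {l : Subs S} (h : Conjunct V A l) : Conjunct V (A.subst θ) (Subs.subst θ l) := by
  cases h with
  | eq V B =>
    rw [Expr.subst, Expr.subst_weaken]
    exact .eq V _
  | one V => exact .one V
  | self V => exact .self V
  | apps V hπ h => exact .apps V hπ h.subst

theorem Conjunction.subst {Γ : Ctx} {Vs : List (Σ ρ : ArgTy, Idx Γ ρ)}
    {A : Expr S Γ (.pred .o)} {l : Subs S} (h : Conjunction Vs A l) :
    Conjunction Vs (A.subst θ) (Subs.subst θ l) := by
  induction h with
  | single h => exact .single h.subst
  | and _ _ ih ih' =>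
    rw [Subs.subst, List.map_append]
    exact .and ih ih'

theorem UnionForm.subst {π : PredTy} {E : Expr S [] (.pred π)} {l : Subs S}
    (h : UnionForm E l) : UnionForm (E.subst θ) (Subs.subst θ l) := by
  induction h with
  | zero hπ =>
    rw [Expr.subst_lams]
    exact .zero hπ
  | conj hπ h =>
    rw [Expr.subst_lams]
    exact .conj hπ h.subst
  | union _ _ ih ih' =>
    rw [Subs.subst, List.map_append]
    exact .union ih ih'

/-- A substitution keeps the shape of a union and acts only on its basic subexpressions, so the
induction reduces to variables. -/
theorem IsBasic.subst (hθ : ∀ ρ V, IsBasic (θ ρ V)) {ρ : ArgTy} {E : Expr S [] ρ}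
    (h : IsBasic E) : IsBasic (E.subst θ) := by
  induction h with
  | ind E => exact .ind _
  | pvar V =>
    rw [Expr.subst, Expr.weaken_nil]
    exact hθ _ V
  | zero => exact .zero
  | one => exact .one
  | union h _ ih =>
    refine .union h.subst fun B hB => ?_
    obtain ⟨B, hB', rfl⟩ := List.mem_map.1 hB
    exact ih B hB'

theorem isBasic_fvar : {ρ : ArgTy} → (V : S.Var ρ) → IsBasic (.fvar V)
  | .ind, _ => .ind _
  | .pred _, V => .pvar V

theorem Subst.Basic.isBasic {θ : Subst S} (h : θ.Basic) (ρ : ArgTy) (V : S.Var ρ) :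
    IsBasic (θ.toFun ρ V) := by
  by_cases hV : θ.toFun ρ V = .fvar V
  · rw [hV]
    exact isBasic_fvar V
  · exact h ⟨ρ, V⟩ hV

theorem Subst.Basic.comp {θ σ : Subst S} (hθ : θ.Basic) (hσ : σ.Basic) : (θ.comp σ).Basic :=
  fun V _ => (hθ.isBasic V.1 V.2).subst hσ.isBasic

theorem Subst.Basic.restrict {θ : Subst S} (hθ : θ.Basic) (X : Set (AnyVar S)) :
    (θ.restrict X).Basic := by
  intro V _
  simp only [Subst.restrict]
  split
  · exact hθ.isBasic _ _
  · exact isBasic_fvar _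

theorem Subst.basic_id : (Subst.id : Subst S).Basic := fun V _ => isBasic_fvar V.2

theorem basic_composite {θ : ℕ → Subst S} {n : ℕ} (h : ∀ i < n, (θ i).Basic) :
    (composite θ n).Basic := by
  induction n with
  | zero => exact Subst.basic_id
  | succ n ih => exact (ih fun i hi => h i (hi.trans n.lt_succ_self)).comp (h n n.lt_succ_self)

theorem Subst.dom_restrict_subset (θ : Subst S) (X : Set (AnyVar S)) :
    (θ.restrict X).dom ⊆ X := by
  intro V hV
  by_contra h
  exact hV (if_neg h)

theorem Subst.apply_restrict_FV (θ : Subst S) {ρ : ArgTy} (E : Expr S [] ρ) :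
    (θ.restrict E.FV).apply E = θ.apply E :=
  E.subst_congr fun _ hV => if_pos hV

end Substitution

section Semantics

variable {S : Signature.{v}} {I : Interp.{u} S}

/-! ### Substitution lemmas -/

theorem denote_rename {Γ : Ctx} {ρ : ArgTy} (E : Expr S Γ ρ) {Δ : Ctx}
    (r : ∀ ρ, Idx Γ ρ → Idx Δ ρ) (s : State S I.D) (e : Env I.D Δ) :
    (E.rename r).denote I (s, e) = E.denote I (s, fun ρ i => e ρ (r ρ i)) := by
  have cons_ren : ∀ {Γ Δ : Ctx} {ρ' : ArgTy} (r : ∀ ρ, Idx Γ ρ → Idx Δ ρ) (e : Env I.D Δ)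
      (d : ρ'.basic I.D), (fun ρ i => Env.cons d e ρ (Expr.liftRen r ρ i)) =
        Env.cons d fun ρ i => e ρ (r ρ i) := by
    intro Γ Δ ρ' r e d
    funext ρ i
    cases i <;> rfl
  induction E generalizing Δ with
  | fapp f E ih => exact congrArg (I.func f) (funext fun i => ih i r e)
  | app E₁ E₂ ih₁ ih₂ => exact congrArg₂ semApp (ih₁ r e) (ih₂ r e)
  | lam E ih =>
    refine OrderHom.ext _ _ (funext fun d => ?_)
    exact (ih _ _).trans (by rw [cons_ren]; rfl)
  | or E₁ E₂ ih₁ ih₂ => exact congrArg₂ (max (α := PredTy.sem I.D _)) (ih₁ r e) (ih₂ r e)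
  | and E₁ E₂ ih₁ ih₂ => exact congrArg₂ (min (α := PredTy.sem I.D _)) (ih₁ r e) (ih₂ r e)
  | eq E₁ E₂ ih₁ ih₂ => exact congrArg₂ (fun x y => ULift.up (x = y)) (ih₁ r e) (ih₂ r e)
  | ex E ih =>
    refine congrArg ULift.up (congrArg Exists (funext fun d => ?_))
    change ((E.rename _).denote I (s, Env.cons d e) = _) = (E.denote I (s, Env.cons d _) = _)
    rw [ih, cons_ren]
  | _ => rfl

theorem denote_weaken {Γ : Ctx} {ρ : ArgTy} (E : Expr S [] ρ) (s : State S I.D)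
    (e : Env I.D Γ) : (E.weaken : Expr S Γ ρ).denote I (s, e) = E.val I s := by
  rw [Expr.weaken, denote_rename, Expr.val]
  congr 2
  funext ρ i
  cases i

/-- Substitution of expressions that denote basic elements amounts to a change of the state. -/
theorem denote_subst {Γ : Ctx} {ρ : ArgTy} (E : Expr S Γ ρ)
    {θ : ∀ ρ, S.Var ρ → Expr S [] ρ} {s s' : State S I.D}
    (h : ∀ ρ V, ρ.incl I.D (s' ρ V) = (θ ρ V).val I s) (e : Env I.D Γ) :
    (E.subst θ).denote I (s, e) = E.denote I (s', e) := by
  induction E with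
  | fvar V => exact (denote_weaken _ _ _).trans (h _ V).symm
  | fapp f E ih => exact congrArg (I.func f) (funext fun i => ih i e)
  | app E₁ E₂ ih₁ ih₂ => exact congrArg₂ semApp (ih₁ e) (ih₂ e)
  | lam E ih => exact OrderHom.ext _ _ (funext fun d => ih _)
  | or E₁ E₂ ih₁ ih₂ => exact congrArg₂ (max (α := PredTy.sem I.D _)) (ih₁ e) (ih₂ e)
  | and E₁ E₂ ih₁ ih₂ => exact congrArg₂ (min (α := PredTy.sem I.D _)) (ih₁ e) (ih₂ e)
  | eq E₁ E₂ ih₁ ih₂ => exact congrArg₂ (fun x y => ULift.up (x = y)) (ih₁ e) (ih₂ e)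
  | ex E ih =>
    refine congrArg ULift.up (congrArg Exists (funext fun d => ?_))
    change ((E.subst _).denote I (s, Env.cons d e) = _) = (E.denote I (s', Env.cons d _) = _)
    rw [ih]
  | _ => rfl

-- Approximation by basic elements and continuity

theorem denote_mono_env {Γ : Ctx} {ρ : ArgTy} (E : Expr S Γ ρ) {s : State S I.D}
    {e e' : Env I.D Γ} (h : e ≤ e') : E.denote I (s, e) ≤ E.denote I (s, e') :=
  (E.denote I).monotone ⟨le_refl s, h⟩

/-- The environments of basic elements that approximate the values of the expressions `σ`. -/
abbrev Approx (I : Interp.{u} S) {Γ Δ : Ctx} (σ : ∀ ρ, Idx Γ ρ → Expr S Δ ρ)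
    (w : Val S I.D Δ) :=
  {a : Env I.D Γ // ∀ ρ i, ρ.incl I.D (a ρ i) ≤ (σ ρ i).denote I w}

instance {Γ Δ : Ctx} (σ : ∀ ρ, Idx Γ ρ → Expr S Δ ρ) (w : Val S I.D Δ) :
    Nonempty (Approx I σ w) :=
  ⟨⟨fun _ _ => (exists_basic_le _).choose, fun _ _ => (exists_basic_le _).choose_spec⟩⟩

theorem Approx.exists_ge_ge {Γ Δ : Ctx} {σ : ∀ ρ, Idx Γ ρ → Expr S Δ ρ} {w : Val S I.D Δ}
    (a a' : Approx I σ w) : ∃ c : Approx I σ w, a.1 ≤ c.1 ∧ a'.1 ≤ c.1 := by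
  choose c hc hc' hcw using fun ρ i => exists_basic_ge_ge (a.1 ρ i) (a'.1 ρ i) (a.2 ρ i) (a'.2 ρ i)
  exact ⟨⟨c, hcw⟩, hc, hc'⟩

theorem Approx.exists_apply_eq {Γ Δ : Ctx} {σ : ∀ ρ, Idx Γ ρ → Expr S Δ ρ} {w : Val S I.D Δ}
    {ρ : ArgTy} (i : Idx Γ ρ) (b : ρ.basic I.D) (hb : ρ.incl I.D b ≤ (σ ρ i).denote I w) :
    ∃ a : Approx I σ w, a.1 ρ i = b := by
  classical
  obtain ⟨a⟩ : Nonempty (Approx I σ w) := inferInstance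
  refine ⟨⟨fun ρ' j => if h : ∃ e : ρ = ρ', e ▸ i = j then h.1 ▸ b else a.1 ρ' j,
    fun ρ' j => ?_⟩, ?_⟩
  · dsimp only
    split_ifs with h
    · obtain ⟨rfl, rfl⟩ := h
      exact hb
    · exact a.2 ρ' j
  · exact dif_pos ⟨rfl, rfl⟩

theorem Approx.directed_denote {Γ Δ : Ctx} {σ : ∀ ρ, Idx Γ ρ → Expr S Δ ρ} {w : Val S I.D Δ}
    {ρ : ArgTy} (E : Expr S Γ ρ) :
    Directed (· ≤ ·) fun a : Approx I σ w => E.denote I (w.1, a.1) := by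
  intro a a'
  obtain ⟨c, hc, hc'⟩ := a.exists_ge_ge a'
  exact ⟨c, denote_mono_env E hc, denote_mono_env E hc'⟩

/-- An approximation of the values of `liftSub σ` consists of a basic element below the value
of the newly bound variable and an approximation of the values of `σ`. -/
theorem Approx.exists_cons_ge {Γ Δ : Ctx} {σ : ∀ ρ, Idx Γ ρ → Expr S Δ ρ} {s : State S I.D}
    {e : Env I.D Δ} {ρ' : ArgTy} {d : ρ'.basic I.D}
    (a : Approx I (Expr.liftSub σ (ρ' := ρ')) (s, Env.cons d e)) :
    ∃ a' : Approx I σ (s, e), a.1 ≤ Env.cons d a'.1 := by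
  refine ⟨⟨fun ρ i => a.1 ρ (.there i), fun ρ i => ?_⟩, fun ρ i => ?_⟩
  · refine (a.2 ρ (.there i)).trans (le_of_eq ?_)
    exact denote_rename _ _ _ _
  · cases i with
    | here => exact incl_le_incl.1 (a.2 _ .here)
    | there i => exact le_rfl

/-- The denotation of an expression is continuous in the values of its bound variables. -/
theorem denote_bsubst_le {Γ : Ctx} {ρ : ArgTy} (E : Expr S Γ ρ) {Δ : Ctx}
    (σ : ∀ ρ, Idx Γ ρ → Expr S Δ ρ) (s : State S I.D) (e : Env I.D Δ) (u : ρ.sem I.D)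
    (hu : ∀ a : Approx I σ (s, e), E.denote I (s, a.1) ≤ u) :
    (E.bsubst σ).denote I (s, e) ≤ u := by
  -- The bound is phrased through an arbitrary upper bound `u` because `⟦ι⟧_D` is only a poset and
  -- need not have suprema. The approximation `a₀` supplies a value where the denotation is
  -- constant.
  obtain ⟨a₀⟩ : Nonempty (Approx I σ (s, e)) := inferInstance
  induction E generalizing Δ with
  | fvar V => exact hu a₀
  | bvar i =>
    refine le_of_forall_basic_le fun b hb => ?_
    obtain ⟨a, rfl⟩ := Approx.exists_apply_eq i b hb
    exact hu a
  | fapp f E ih =>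
    -- In the discrete order on `D` the directed family of values of each argument is constant,
    -- hence equal to its value at `a₀`.
    refine le_trans (le_of_eq ?_) (hu a₀)
    refine congrArg (I.func f) (funext fun i => ?_)
    refine ih i σ e _ (fun a => ?_) a₀
    obtain ⟨c, hc, hc'⟩ := Approx.directed_denote (E i) a a₀
    exact Eq.trans hc (Eq.symm hc')
  | app E₁ E₂ ih₁ ih₂ =>
    refine le_iff_eval.2 fun t ht => ?_
    obtain ⟨b, hb, ht⟩ := eval_semApp.1 ht
    -- The witness `b` of the application is basic, so one approximation `a₂` already puts it below
    -- `E₂`. Another, `a₁`, makes `E₁` true at `b` and `t`; a common upper bound does both.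
    obtain ⟨a₂, h₂⟩ := exists_le_of_directed (Approx.directed_denote E₂)
      (fun u hu => ih₂ σ e u hu a₀) b hb
    obtain ⟨a₁, h₁⟩ := eval_iSup.1 (le_iff_eval.1
      (ih₁ σ e (iSup (α := PredTy.sem I.D _) fun a : Approx I σ (s, e) => E₁.denote I (s, a.1))
        (le_iSup (α := PredTy.sem I.D _) _) a₀) (.cons b t) ht)
    obtain ⟨c, hc₁, hc₂⟩ := a₁.exists_ge_ge a₂
    exact le_iff_eval.1 (hu c) t (eval_semApp.2 ⟨b, h₂.trans (denote_mono_env E₂ hc₂),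
      le_iff_eval.1 (denote_mono_env E₁ hc₁) (.cons b t) h₁⟩)
  | lam E ih =>
    intro d
    obtain ⟨a₁⟩ : Nonempty (Approx I (Expr.liftSub σ) (s, Env.cons d e)) := inferInstance
    refine ih (Expr.liftSub σ) (Env.cons d e) _ (fun a => ?_) a₁
    obtain ⟨a', ha'⟩ := a.exists_cons_ge
    exact (denote_mono_env E ha').trans (hu a' d)
  | or E₁ E₂ ih₁ ih₂ =>
    exact sup_le (α := PredTy.sem I.D _)
      (ih₁ σ e u (fun a => (le_sup_left (α := PredTy.sem I.D _)).trans (hu a)) a₀)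
      (ih₂ σ e u (fun a => (le_sup_right (α := PredTy.sem I.D _)).trans (hu a)) a₀)
  | and E₁ E₂ ih₁ ih₂ =>
    -- Testing against basic elements `b` lets compactness select one approximation for each side of
    -- the meet, and directedness merges the two.
    refine le_of_forall_basic_le fun b hb => ?_
    obtain ⟨a₁, h₁⟩ := exists_le_of_directed (Approx.directed_denote E₁)
      (fun u hu => ih₁ σ e u hu a₀) b (le_trans hb (inf_le_left (α := PredTy.sem I.D _)))
    obtain ⟨a₂, h₂⟩ := exists_le_of_directed (Approx.directed_denote E₂)
      (fun u hu => ih₂ σ e u hu a₀) b (le_trans hb (inf_le_right (α := PredTy.sem I.D _)))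
    obtain ⟨c, hc₁, hc₂⟩ := a₁.exists_ge_ge a₂
    exact le_trans (le_inf (α := PredTy.sem I.D _)
      (h₁.trans (denote_mono_env E₁ hc₁))
      (h₂.trans (denote_mono_env E₂ hc₂))) (hu c)
  | eq E₁ E₂ ih₁ ih₂ =>
    intro h
    refine hu a₀ ?_
    have key : ∀ E : Expr S _ .ind, (∀ (u : ArgTy.ind.sem I.D),
        (∀ a : Approx I σ (s, e), E.denote I (s, a.1) ≤ u) →
          (E.bsubst σ).denote I (s, e) ≤ u) →
        (E.bsubst σ).denote I (s, e) = E.denote I (s, a₀.1) := fun E ih => by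
      refine ih _ fun a => ?_
      obtain ⟨c, hc, hc'⟩ := Approx.directed_denote E a a₀
      exact Eq.trans hc (Eq.symm hc')
    exact (key E₁ fun u hu => ih₁ σ e u hu a₀).symm.trans
      (Eq.trans h (key E₂ fun u hu => ih₂ σ e u hu a₀))
  | ex E ih =>
    rintro ⟨d, hd⟩
    obtain ⟨a₁⟩ : Nonempty (Approx I (Expr.liftSub σ) (s, Env.cons d e)) := inferInstance
    have := ih (Expr.liftSub σ) (Env.cons d e) u (fun a h => ?_) a₁
    · rw [hd] at this
      exact this trivial
    obtain ⟨a', ha'⟩ := a.exists_cons_ge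
    exact hu a' ⟨d, ULift.ext _ _ (eq_true (denote_mono_env E ha' h))⟩
  | _ => exact hu a₀

end Semantics

section Soundness

variable {S : Signature.{v}} {I : Interp.{u} S}

/-! ### Application to several arguments -/

/-- The members of the tuple are below the values of the arguments. -/
def Args.Above (I : Interp.{u} S) {Γ : Ctx} (w : Val S I.D Γ) :
    {π : PredTy} → Args S Γ π → Tuple I.D π → Prop
  | _, .nil, .nil => True
  | .arr ρ _, .cons E as, .cons d t => ρ.incl I.D d ≤ E.denote I w ∧ as.Above I w t

theorem Args.Above.exists_ge_ge {Γ : Ctx} {w : Val S I.D Γ} {π : PredTy} {as : Args S Γ π}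
    {t t' : Tuple I.D π} (h : as.Above I w t) (h' : as.Above I w t') :
    ∃ c, as.Above I w c ∧ t.Le c ∧ t'.Le c := by
  induction as with
  | nil =>
    cases t
    cases t'
    exact ⟨.nil, trivial, trivial, trivial⟩
  | cons E as ih =>
    cases t with | cons d t =>
    cases t' with | cons d' t' =>
    obtain ⟨c, hc, htc, htc'⟩ := ih h.2 h'.2
    obtain ⟨b, hdb, hdb', hb⟩ := exists_basic_ge_ge d d' h.1 h'.1
    exact ⟨.cons b c, ⟨hb, hc⟩, ⟨hdb, htc⟩, ⟨hdb', htc'⟩⟩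

/-- Each semantic application contributes an existential over basic elements below its argument;
together they form one existential over tuples. -/
theorem eval_applyArgs {Γ : Ctx} {w : Val S I.D Γ} {π : PredTy} (E : Expr S Γ (.pred π))
    (as : Args S Γ π) :
    eval (D := I.D) (π := .o) ((E.applyArgs as).denote I w) .nil ↔
      ∃ t, as.Above I w t ∧ eval (π := π) (E.denote I w) t := by
  induction as with
  | nil => exact ⟨fun h => ⟨.nil, trivial, h⟩, fun ⟨t, _, h⟩ => by cases t; exact h⟩
  | cons E' as ih =>
    refine (ih (E.app E')).trans ⟨?_, ?_⟩
    · rintro ⟨t, ht, h⟩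
      obtain ⟨b, hb, h⟩ := eval_semApp.1 h
      exact ⟨.cons b t, ⟨hb, ht⟩, h⟩
    · rintro ⟨t, ht, h⟩
      cases t with | cons b t =>
      exact ⟨t, ht.2, eval_semApp.2 ⟨b, ht.1, h⟩⟩

theorem eval_applyArgs_mono {Γ : Ctx} {w : Val S I.D Γ} {π : PredTy}
    {E E' : Expr S Γ (.pred π)} (h : E.denote I w ≤ E'.denote I w) (as : Args S Γ π) :
    eval (D := I.D) (π := .o) ((E.applyArgs as).denote I w) .nil →
      eval (D := I.D) (π := .o) ((E'.applyArgs as).denote I w) .nil := by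
  rw [eval_applyArgs, eval_applyArgs]
  exact fun ⟨t, ht, hE⟩ => ⟨t, ht, le_iff_eval.1 h t hE⟩

/-! ### Basic expressions denote basic elements -/

/-- The value of the expression is a basic element. -/
def DenotesBasic (I : Interp.{u} S) (s : State S I.D) {ρ : ArgTy} (E : Expr S [] ρ) : Prop :=
  ∃ b : ρ.basic I.D, ρ.incl I.D b = E.val I s

variable {s : State S I.D}

theorem Args.exists_above_weaken_iff {π : PredTy} {as : Args S [] π}
    (h : ∀ B ∈ as.toList, DenotesBasic I s B.2) :
    ∃ c : Tuple I.D π, ∀ {Γ : Ctx} (e : Env I.D Γ) (t : Tuple I.D π),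
      as.weaken.Above I (s, e) t ↔ t.Le c := by
  induction as with
  | nil => exact ⟨.nil, fun e t => by cases t; exact Iff.rfl⟩
  | cons E as ih =>
    obtain ⟨c, hc⟩ := ih fun B hB => h B (List.mem_cons_of_mem _ hB)
    obtain ⟨b, hb⟩ := h ⟨_, E⟩ List.mem_cons_self
    refine ⟨.cons b c, fun e t => ?_⟩
    cases t with | cons d t =>
    refine and_congr ?_ (hc e t)
    rw [denote_weaken, ← hb, incl_le_incl]

/-- When the arguments denote the basic tuple `c`, truth of `V(B₁)⋯(Bᵣ)` means `step c ≤ V`. A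
conjunction of such conditions takes the join of the thresholds. -/
theorem Apps.exists_basic {Γ : Ctx} {π : PredTy} {V : Idx Γ (.pred π)}
    {A : Expr S Γ (.pred .o)} {l : Subs S} (h : Apps V A l)
    (hl : ∀ B ∈ l, DenotesBasic I s B.2) :
    ∃ c : (ArgTy.pred π).basic I.D, ∀ e : Env I.D Γ,
      eval (D := I.D) (π := .o) (A.denote I (s, e)) .nil ↔ c ≤ e _ V := by
  induction h with
  | single as =>
    obtain ⟨c, hc⟩ := Args.exists_above_weaken_iff hl
    refine ⟨⟨step c, isCompactElement_step c⟩, fun e => ?_⟩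
    rw [eval_applyArgs]
    refine Iff.trans ?_ step_le_iff.symm
    exact ⟨fun ⟨t, ht, h⟩ => eval_mono_tuple ((hc e t).1 ht) h,
      fun h => ⟨c, (hc e c).2 (.refl c), h⟩⟩
  | and _ _ ih ih' =>
    obtain ⟨c, hc⟩ := ih fun B hB => hl B (List.mem_append_left _ hB)
    obtain ⟨c', hc'⟩ := ih' fun B hB => hl B (List.mem_append_right _ hB)
    refine ⟨⟨(c.1 ⊔ c'.1 : π.sem I.D), isCompactElement_sup c.2 c'.2⟩, fun e => ?_⟩
    exact (and_congr (hc e) (hc' e)).trans (sup_le_iff (α := π.sem I.D)).symm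

/-- The threshold is the value of `B` for `V ≈ B`, where order is equality; `⊥` for `1`; and the
truth value 1 for `V` itself. -/
theorem Conjunct.exists_basic {Γ : Ctx} {ρ : ArgTy} {V : Idx Γ ρ}
    {A : Expr S Γ (.pred .o)} {l : Subs S} (h : Conjunct V A l)
    (hl : ∀ B ∈ l, DenotesBasic I s B.2) :
    ∃ c : ρ.basic I.D, ∀ e : Env I.D Γ,
      eval (D := I.D) (π := .o) (A.denote I (s, e)) .nil ↔ c ≤ e _ V := by
  cases h with
  | eq V B =>
    refine ⟨B.val I s, fun e => ?_⟩
    change e _ V = B.weaken.denote I (s, e) ↔ _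
    rw [denote_weaken]
    exact eq_comm
  | one V =>
    exact ⟨⟨_, isCompactElement_bot⟩, fun e => iff_of_true trivial (bot_le (α := PredTy.sem I.D _))⟩
  | self V => exact ⟨⟨_, isCompactElement_step .nil⟩, fun e => step_le_iff.symm⟩
  | apps V _ h => exact h.exists_basic hl

theorem Conjunction.exists_basic {Γ : Ctx} {Vs : List (Σ ρ : ArgTy, Idx Γ ρ)}
    {A : Expr S Γ (.pred .o)} {l : Subs S} (h : Conjunction Vs A l)
    (hl : ∀ B ∈ l, DenotesBasic I s B.2) :
    ∃ cs : List (Σ ρ : ArgTy, Idx Γ ρ × ρ.basic I.D),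
      cs.map (fun c => ⟨c.1, c.2.1⟩) = Vs ∧ ∀ e : Env I.D Γ,
        eval (D := I.D) (π := .o) (A.denote I (s, e)) .nil ↔ ∀ c ∈ cs, c.2.2 ≤ e _ c.2.1 := by
  induction h with
  | single h =>
    obtain ⟨c, hc⟩ := h.exists_basic hl
    exact ⟨[⟨_, _, c⟩], rfl, fun e => (hc e).trans (by simp)⟩
  | and _ _ ih ih' =>
    obtain ⟨cs, rfl, hc⟩ := ih fun B hB => hl B (List.mem_append_left _ hB)
    obtain ⟨cs', rfl, hc'⟩ := ih' fun B hB => hl B (List.mem_append_right _ hB)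
    exact ⟨cs ++ cs', List.map_append, fun e =>
      (and_congr (hc e) (hc' e)).trans List.forall_mem_append.symm⟩

-- Iterated abstractions and unions

/-- Assign the members of a tuple to newly bound variables. -/
def Env.extend {D : Type u} : {π : PredTy} → {Γ : Ctx} → Env D Γ → Tuple D π → Env D (π.ctx Γ)
  | _, _, e, .nil => e
  | _, _, e, .cons d t => (Env.cons d e).extend t

theorem Env.extend_liftIdx {D : Type u} {ρ : ArgTy} : {π : PredTy} → {Γ : Ctx} →
    (e : Env D Γ) → (t : Tuple D π) → (i : Idx Γ ρ) → e.extend t ρ (π.liftIdx i) = e ρ i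
  | _, _, _, .nil, _ => rfl
  | _, _, e, .cons d t, i => Env.extend_liftIdx (Env.cons d e) t (.there i)

theorem eval_lams : {π : PredTy} → {Γ : Ctx} → (A : Expr S (π.ctx Γ) (.pred .o)) →
    (e : Env I.D Γ) → (t : Tuple I.D π) →
    (eval (π := π) ((Expr.lams π A).denote I (s, e)) t ↔
      eval (D := I.D) (π := .o) (A.denote I (s, e.extend t)) .nil)
  | _, _, _, _, .nil => Iff.rfl
  | .arr _ π, _, A, e, .cons d t => eval_lams (π := π) A (Env.cons d e) t

/-- Thresholds are collected as a list because conjunctions associate in any way; since the list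
follows `V₁, …, Vₙ`, it can be read as one tuple. -/
theorem exists_tuple_of_map_eq_vars {D : Type u} : {π : PredTy} → {Γ : Ctx} →
    (cs : List (Σ ρ : ArgTy, Idx (π.ctx Γ) ρ × ρ.basic D)) →
    cs.map (fun c => ⟨c.1, c.2.1⟩) = π.vars Γ →
    ∃ c : Tuple D π, ∀ (e : Env D Γ) (t : Tuple D π),
      (∀ c ∈ cs, c.2.2 ≤ e.extend t _ c.2.1) ↔ c.Le t
  | .o, _, [], _ => ⟨.nil, fun e t => by cases t; simp [Tuple.Le]⟩
  | .arr ρ π, Γ, [], h => by simp [PredTy.vars] at h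
  | .arr ρ π, Γ, ⟨ρ', i, b⟩ :: cs, h => by
    have h₁ : (⟨ρ', i⟩ : Σ τ : ArgTy, Idx (π.ctx (ρ :: Γ)) τ) = ⟨ρ, π.liftIdx .here⟩ :=
      (List.cons.inj h).1
    have h₂ := (List.cons.inj h).2
    cases h₁
    obtain ⟨c, hc⟩ := exists_tuple_of_map_eq_vars (π := π) cs h₂
    refine ⟨.cons b c, fun e t => ?_⟩
    cases t with | cons d t =>
    rw [List.forall_mem_cons]
    refine and_congr ?_ (hc (Env.cons d e) t)
    change b ≤ (Env.cons d e).extend t _ (π.liftIdx .here) ↔ _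
    rw [Env.extend_liftIdx]
    rfl

/-- The three forms denote `⊥`, a `step c`, and a join of two compact elements. -/
theorem UnionForm.denotesBasic {π : PredTy} {E : Expr S [] (.pred π)} {l : Subs S}
    (h : UnionForm E l) (hl : ∀ B ∈ l, DenotesBasic I s B.2) : DenotesBasic I s E := by
  induction h with
  | zero _ =>
    refine ⟨⟨_, isCompactElement_bot⟩, le_antisymm (bot_le (α := π.sem I.D)) ?_⟩
    refine le_iff_eval.2 fun t ht => ?_
    exact ((eval_lams .zero (Env.nil I.D) t).1 ht).elim
  | conj _ h =>
    obtain ⟨cs, hcs, hA⟩ := h.exists_basic hl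
    obtain ⟨c, hc⟩ := exists_tuple_of_map_eq_vars cs hcs
    have key : ∀ t, eval (π := π) (Expr.val (Expr.lams π _) I s) t ↔ eval (step c) t := fun t =>
      ((eval_lams _ (Env.nil I.D) t).trans (hA _)).trans ((hc _ t).trans eval_step.symm)
    exact ⟨⟨step c, isCompactElement_step c⟩, le_antisymm
      (le_iff_eval.2 fun t => (key t).2) (le_iff_eval.2 fun t => (key t).1)⟩
  | union _ _ ih ih' =>
    obtain ⟨b, hb⟩ := ih fun B hB => hl B (List.mem_append_left _ hB)
    obtain ⟨b', hb'⟩ := ih' fun B hB => hl B (List.mem_append_right _ hB)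
    exact ⟨⟨(b.1 ⊔ b'.1 : π.sem I.D), isCompactElement_sup b.2 b'.2⟩,
      congrArg₂ (max (α := π.sem I.D)) hb hb'⟩

theorem IsBasic.denotesBasic {ρ : ArgTy} {E : Expr S [] ρ} (h : IsBasic E) :
    DenotesBasic I s E := by
  induction h with
  | ind E => exact ⟨E.val I s, rfl⟩
  | pvar V => exact ⟨s _ V, rfl⟩
  | zero => exact ⟨⟨_, isCompactElement_bot⟩, rfl⟩
  | one => exact ⟨⟨_, isCompactElement_step .nil⟩, rfl⟩
  | union h _ ih => exact h.denotesBasic ih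

/-- Application of a basic substitution amounts to a change of the state. -/
theorem Subst.Basic.exists_state {θ : Subst S} (hθ : θ.Basic) (s : State S I.D) :
    ∃ s' : State S I.D, ∀ {ρ : ArgTy} (E : Expr S [] ρ), (θ.apply E).val I s = E.val I s' := by
  choose s' hs' using fun ρ V => (hθ.isBasic ρ V).denotesBasic (I := I) (s := s)
  exact ⟨s', fun E => denote_subst E hs' _⟩

/-! ### Soundness -/

theorem isTrue_iff_eval {A : Formula S} :
    A.IsTrue I s ↔ eval (D := I.D) (π := .o) (A.val I s) .nil :=
  ⟨fun h => by rw [h]; trivial, fun h => ULift.ext _ _ (eq_true h)⟩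

theorem Formula.isTrue_and {A B : Formula S} :
    Formula.IsTrue (.and A B) I s ↔ A.IsTrue I s ∧ B.IsTrue I s := by
  simp only [isTrue_iff_eval]
  exact Iff.rfl

theorem Env.eq_cons_nil {D : Type u} {ρ : ArgTy} (e : Env D [ρ]) :
    e = Env.cons (e ρ .here) (Env.nil D) := by
  funext _ i
  cases i with
  | here => rfl
  | there i => cases i

theorem Subst.id_apply {ρ : ArgTy} (E : Expr S [] ρ) : Subst.id.apply E = E := E.subst_fvar

theorem Subst.comp_apply (θ σ : Subst S) {ρ : ArgTy} (E : Expr S [] ρ) :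
    (θ.comp σ).apply E = σ.apply (θ.apply E) :=
  (E.subst_subst _ _).symm

/-- If a formula is derived in one step from `A` using `θ`, then it implies `Aθ` in each model. -/
theorem StepAvoiding.isTrue {P : Program S} (hI : I.IsModel P) {X : Set (AnyVar S)}
    {A A' : Formula S} {θ : Subst S} (h : StepAvoiding P X A θ A') (s : State S I.D) :
    A'.IsTrue I s → Formula.IsTrue (θ.apply A) I s := by
  induction h with
  | clause c hc as =>
    rw [Subst.id_apply, isTrue_iff_eval, isTrue_iff_eval]
    exact eval_applyArgs_mono (hI c hc s) as
  | template => exact fun h => h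
  | beta E E₁ as =>
    rw [Subst.id_apply, isTrue_iff_eval, isTrue_iff_eval]
    -- Each approximation of `E₁` is one of the basic elements in the supremum that defines the
    -- value of the redex.
    refine eval_applyArgs_mono (E' := .app (.lam E) E₁) (denote_bsubst_le E _ s _ _ fun a => ?_) as
    refine le_iff_eval.2 fun t ht => eval_semApp.2 ⟨a.1 _ .here, a.2 _ .here, ?_⟩
    rw [Env.eq_cons_nil a.1] at ht
    exact ht
  | orLeft E E' as =>
    rw [Subst.id_apply, isTrue_iff_eval, isTrue_iff_eval]
    exact eval_applyArgs_mono (le_sup_left (α := PredTy.sem I.D _)) as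
  | orRight E E' as =>
    rw [Subst.id_apply, isTrue_iff_eval, isTrue_iff_eval]
    exact eval_applyArgs_mono (le_sup_right (α := PredTy.sem I.D _)) as
  | andApp E E' as _ =>
    rw [Subst.id_apply, Formula.isTrue_and]
    simp only [isTrue_iff_eval, Expr.val, eval_applyArgs]
    rintro ⟨⟨t, ht, hE⟩, t', ht', hE'⟩
    -- The conjuncts may be true at different tuples below the arguments; by monotonicity both are
    -- true at a common upper bound.
    obtain ⟨c, hc, htc, htc'⟩ := ht.exists_ge_ge ht'
    exact ⟨c, hc, eval_inf.2 ⟨eval_mono_tuple htc hE, eval_mono_tuple htc' hE'⟩⟩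
  | andLeft E₂ _ ih => exact fun h => Formula.isTrue_and.2 ((Formula.isTrue_and.1 h).imp_left ih)
  | andRight E₁ _ ih => exact fun h => Formula.isTrue_and.2 ((Formula.isTrue_and.1 h).imp_right ih)
  | oneAnd E =>
    rw [Subst.id_apply, Formula.isTrue_and]
    exact fun h => ⟨rfl, h⟩
  | andOne E =>
    rw [Subst.id_apply, Formula.isTrue_and]
    exact fun h => ⟨h, rfl⟩
  | eq E₁ E₂ θ h =>
    intro _
    exact isTrue_iff_eval.2 (congrArg (fun E => Expr.val E I s) h.1.2)
  | ex E V _ =>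
    rw [Subst.id_apply, isTrue_iff_eval, isTrue_iff_eval]
    -- The approximation of the value of `V` at which `E` is true is the existential witness.
    refine le_iff_eval.1 (denote_bsubst_le E _ s _ (Expr.val (.ex E) I s) fun a h => ?_) .nil
    rw [Env.eq_cons_nil a.1] at h
    exact ⟨_, ULift.ext _ _ (eq_true h)⟩

theorem IsDerivation.isTrue {P : Program S} (hI : I.IsModel P) {n : ℕ} {G : ℕ → Formula S}
    {θ : ℕ → Subst S} (h : IsDerivation P n G θ) {k : ℕ} (hk : k ≤ n) (s : State S I.D) :
    (G k).IsTrue I s → Formula.IsTrue ((composite θ k).apply (G 0)) I s := by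
  induction k generalizing s with
  | zero =>
    rw [composite, Subst.id_apply]
    exact fun h => h
  | succ k ih =>
    intro hG
    -- `θ k` is traded for the state `s'`, at which the induction hypothesis applies, and is then
    -- restored as the last factor of the composite. Hence the induction runs over all states.
    obtain ⟨s', hs'⟩ := (h.basic k hk).exists_state (I := I) s
    have hG' := (h.step k hk).isTrue hI s hG
    rw [Formula.IsTrue, hs'] at hG'
    have := ih (Nat.le_of_succ_le hk) s' hG'
    rw [Formula.IsTrue, ← hs'] at this
    rw [composite, Subst.comp_apply]
    exact this

end Soundness

end HOLP

theorem mainTheorem5 (S : HOLP.Signature.{v}) (P : HOLP.Program S) (A : HOLP.Formula S)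
    (σ : HOLP.Subst S) (h : HOLP.IsComputedAnswer P A σ) :
    HOLP.IsCorrectAnswer.{u} P A σ := by
  obtain ⟨n, _, ⟨G, θ, hG, rfl, hn, rfl⟩, rfl⟩ := h
  refine ⟨⟨(HOLP.basic_composite hG.basic).restrict _, HOLP.Subst.dom_restrict_subset _ _⟩,
    fun M hM s => ?_⟩
  -- Restricting to the free variables of the goal does not change the instance of the goal.
  rw [HOLP.Subst.apply_restrict_FV]
  refine hG.isTrue hM le_rfl s ?_
  rw [hn]
  rfl
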